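/- Let $d\ge 3$ and let $Q$ be the transition matrix of simple random walk on $\mathbb Z^d$. A based loop is a sequence $(x_1,\dots,x_n)$ in $\mathbb Z^d$ with $n\ge 2$, $x_i\ne x_{i+1}$ for $1\le i<n$ and $x_n\ne x_1$; a loop is an equivalence class of based loops under circular permutation. Let $\mu$ be the push-forward to the space of loops of the measure giving the based loop $(x_1,\dots,x_n)$ the mass $\frac1n Q(x_1,x_2)\cdots Q(x_{n-1},x_n)Q(x_n,x_1)$. For $\alpha>0$ let $\mathcal L_\alpha$ be the Poisson point process of loops with intensity $\alpha\mu$. An edge of $\mathbb Z^d$ is open if at least one loop of $\mathcal L_\alpha$ traverses it. For $A,B\subseteq\mathbb Z^d$ write $A\overset{\mathcal L_\alpha}{\longleftrightarrow}B$ if some vertex of $A$ and some vertex of $B$ lie in the same connected component of the graph of open edges, and write $0$ for $\{0\}$. Let $B(0,n)=\{x\in\mathbb Z^d:\|x\|_\infty\le n\}$, and let $\partial F$ be the set of vertices of $F$ that have a nearest neighbour outside $F$. Define $$\alpha_1=\alpha_1(d)=\sup_{\beta>1}\,\inf\Bigl\{\alpha>0:\limsup_{n\to\infty}\mathbb P\bigl[B(0,n)\overset{\mathcal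 L_\alpha}{\longleftrightarrow}\partial B(0,\lceil\beta n\rceil)\bigr]=1\Bigr\}\in[0,\infty].$$ **Theorem.** Let $d\ge 3$. (a) $\alpha_1>0$. (b) For every $\alpha\in(0,\alpha_1)$ there are constants $C(d,\alpha)<\infty$ and $c(d,\alpha)>0$, with $\lim_{\alpha\to0}c(d,\alpha)=d-2$, such that for all integers $N\ge 1$ $$\mathbb P\bigl[0\overset{\mathcal L_\alpha}{\longleftrightarrow}\partial B(0,N)\bigr]\le C(d,\alpha)\,N^{-c(d,\alpha)}.$$ Moreover, there is $K_0(d)\in(0,\infty)$ such that, for every constant $K\ge K_0(d)$, the constants can be chosen so that in addition $c(d,\alpha)=d-2-K\,\bigl(\log\tfrac1\alpha\bigr)^{-1}$ for all sufficiently small $\alpha>0$. -/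

import Mathlib

open MeasureTheory ProbabilityTheory Filter Topology
open scoped NNReal ENNReal

namespace LoopPercolation

/-- The nearest-neighbour graph on `ℤ^d`. -/
def lattice (d : ℕ) : SimpleGraph (Fin d → ℤ) where
  Adj x y := ∑ i, |x i - y i| = 1
  symm := ⟨fun x y h => by simpa only [abs_sub_comm] using h⟩
  loopless := ⟨fun x h => by simp at h⟩

/-- Transition matrix of the simple random walk on `ℤ^d` (every vertex has `2 * d` neighbours). -/
noncomputable def srw (d : ℕ) (x y : Fin d → ℤ) : ℝ≥0 :=
  open Classical in if (lattice d).Adj x y then 1 / (2 * (d : ℝ≥0)) else 0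

/-- Non-trivial discrete loops on `ℤ^d`: sequences `(x₁, …, xₙ)` with `n ≥ 2`, `xᵢ ≠ xᵢ₊₁` and
`xₙ ≠ x₁`, modulo circular permutation. A based loop is a list, and `Cycle` is the quotient of lists
by rotation. -/
abbrev Loop (d : ℕ) : Type :=
  {c : Cycle (Fin d → ℤ) // 2 ≤ c.length ∧ c.Chain (fun x y => x ≠ y)}

/-- Weight `(1/n) Q(x₁,x₂) ⋯ Q(xₙ₋₁,xₙ) Q(xₙ,x₁)` of the based loop `(x₁, …, xₙ)`. -/
noncomputable def basedWeight (d : ℕ) (l : List (Fin d → ℤ)) : ℝ≥0 :=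
  1 / (l.length : ℝ≥0) * (List.zipWith (srw d) l (l.rotate 1)).prod

/-- The mass of the loop `ℓ` under the loop measure `μ`, the push-forward of the measure on based
loops: the sum of the weights of the (finitely many, distinct) based loops in the class `ℓ`. -/
noncomputable def loopMass (d : ℕ) (ℓ : Loop d) : ℝ≥0 :=
  ∑ l ∈ ℓ.1.lists.toFinset, basedWeight d l

/-- The law of the Poisson loop ensemble of intensity `α μ`. A configuration records the multiplicity
of each loop. Since the space of loops is countable, a Poisson random measure with intensity `α μ`
amounts to independent multiplicities, that of `ℓ` being Poisson with parameter `α μ({ℓ})`. -/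
noncomputable def loopLaw (d : ℕ) (α : ℝ≥0) : Measure (Loop d → ℕ) :=
  Measure.infinitePi fun ℓ => poissonMeasure (α * loopMass d ℓ)

/-- The loop `ℓ` steps from `x` to `y`: one of its based representatives starts with `x, y`. -/
def Loop.Steps {d : ℕ} (ℓ : Loop d) (x y : Fin d → ℤ) : Prop :=
  ∃ l : List (Fin d → ℤ), ((x :: y :: l : List (Fin d → ℤ)) : Cycle (Fin d → ℤ)) = ℓ.1

/-- The graph of open edges: the edges of `ℤ^d` traversed, in either direction, by at least one loop
of the configuration `ω`. -/
def openGraph (d : ℕ) (ω : Loop d → ℕ) : SimpleGraph (Fin d → ℤ) where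
  Adj x y := (lattice d).Adj x y ∧ ∃ ℓ : Loop d, 1 ≤ ω ℓ ∧ (ℓ.Steps x y ∨ ℓ.Steps y x)
  symm := ⟨fun _ _ h => ⟨h.1.symm, h.2.imp fun _ hl => ⟨hl.1, hl.2.symm⟩⟩⟩
  loopless := ⟨fun _ h => h.1.ne rfl⟩

/-- The probability that some vertex of `A` and some vertex of `B` lie in the same open cluster of the
Poisson loop ensemble of intensity `α μ`. -/
noncomputable def connectProb (d : ℕ) (α : ℝ≥0) (A B : Set (Fin d → ℤ)) : ℝ :=
  (loopLaw d α).real {ω | ∃ x ∈ A, ∃ y ∈ B, (openGraph d ω).Reachable x y}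

/-- The box `B(0,n)` of side length `2n` centred at the origin. -/
def box (d n : ℕ) : Set (Fin d → ℤ) := {x | ∀ i, |x i| ≤ n}

/-- The (inner vertex) boundary of a set of vertices of `ℤ^d`. -/
def boundary {d : ℕ} (F : Set (Fin d → ℤ)) : Set (Fin d → ℤ) :=
  {x | x ∈ F ∧ ∃ y, y ∉ F ∧ (lattice d).Adj x y}

/-- The annulus-crossing threshold
`sup_{β > 1} inf {α > 0 : limsup_n P[B(0,n) ↔ ∂B(0,⌈βn⌉)] = 1}`, in `[0, ∞]`. -/
noncomputable def crossingThreshold (d : ℕ) : ℝ≥0∞ :=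
  ⨆ β : {β : ℝ // 1 < β},
    ⨅ α ∈ {α : ℝ≥0 | 0 < α ∧
      limsup (fun n : ℕ => connectProb d α (box d n) (boundary (box d ⌈β.1 * n⌉₊))) atTop = 1},
      (α : ℝ≥0∞)

end LoopPercolation

namespace LoopPercolation

/-! Everything rests on one estimate for the loop measure: loops crossing from radius n to radius m
≥ 2dn have mass O((n/m)^(d-2)) (`exists_loopMeasure_bound`). A crossing loop can be rooted at its
last vertex of the inner ball before an excursion outward, so its weight splits into an escape path
and a return path. The return paths are controlled by the Green function, bounded through an
explicit superharmonic function. The escape probabilities sum to O(n^(d-2)), by summation by parts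
against a paraboloid (`sum_escape_le`).

Positivity of the threshold is a renormalization. A crossing at scale n yields crossings of two
distant annuli at a smaller comparable scale k. Either they use disjoint families of loops and are
independent, or one loop joins the two regions. Hence q_n ≤ D(q_k² + αC), and for small α a bound q
≤ κα passes from small scales to all scales (`exists_loopLaw_arm_le`).

For the decay, space is cut into geometric shells, each containing a middle annulus between two
buffers. At each scale, either the middle annulus is crossed using loops confined to the shell, or
some loop touching the middle annulus leaves the shell. Unconfined loops are sorted by the first and
last scale at which this happens. The resulting loop families are disjoint, so all events are
independent. Summing over the possible sets of jumps gives exponential decay in the number of shells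
(`measureReal_scales_le`, `loopLaw_arm_le_pow`).

Below the threshold a crossing probability p < 1 together with wide buffers gives some positive
exponent. At small intensity each shell costs O(α), while it suffices that a single buffer has ratio
about α^(-1/(d-2)). Thus the decay is (Γα)^k at distance about (const · α^(-1/(d-2)))^k, which gives
d-2 with an error of order 1/log(1/α) (`exists_arm_decay_small`). -/

/-! ### Geometry of the lattice -/

/-- The vertices of `ℤ^d`. -/
abbrev Site (d : ℕ) : Type := Fin d → ℤ

/-- The sup-norm distance on `ℤ^d`. -/
def rad {d : ℕ} (x₀ x : Site d) : ℕ := Finset.univ.sup fun i => (x i - x₀ i).natAbs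

theorem rad_le_iff {d : ℕ} {x₀ x : Site d} {n : ℕ} : rad x₀ x ≤ n ↔ ∀ i, |x i - x₀ i| ≤ n := by
  simp only [rad, Finset.sup_le_iff, Finset.mem_univ, true_imp_iff]
  exact forall_congr' fun i => by rw [Int.abs_eq_natAbs]; omega

theorem abs_sub_le_rad {d : ℕ} (x₀ x : Site d) (i : Fin d) : |x i - x₀ i| ≤ rad x₀ x :=
  rad_le_iff.1 le_rfl i

theorem exists_abs_sub_eq_rad {d : ℕ} (hd : 0 < d) (x₀ x : Site d) :
    ∃ i, |x i - x₀ i| = rad x₀ x := by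
  have : Nonempty (Fin d) := ⟨⟨0, hd⟩⟩
  obtain ⟨i, -, hi⟩ := Finset.exists_mem_eq_sup (Finset.univ : Finset (Fin d))
    Finset.univ_nonempty (fun i => (x i - x₀ i).natAbs)
  exact ⟨i, by rw [rad, hi]; simp⟩

theorem rad_comm {d : ℕ} (x y : Site d) : rad x y = rad y x := by
  simp only [rad]
  congr 1
  funext i
  omega

@[simp] theorem rad_self {d : ℕ} (x : Site d) : rad x x = 0 :=
  Nat.le_zero.1 (rad_le_iff.2 fun i => by simp)

theorem rad_triangle {d : ℕ} (x y z : Site d) : rad x z ≤ rad x y + rad y z := by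
  refine rad_le_iff.2 fun i => ?_
  have h1 := abs_sub_le_rad x y i
  have h2 := abs_sub_le_rad y z i
  have h3 := abs_sub_le (z i) (y i) (x i)
  push_cast
  linarith

theorem rad_le_add_one_of_adj {d : ℕ} {x y : Site d} (h : (lattice d).Adj x y) (x₀ : Site d) :
    rad x₀ y ≤ rad x₀ x + 1 := by
  refine (rad_triangle x₀ x y).trans (Nat.add_le_add_left ?_ _)
  refine rad_le_iff.2 fun i => ?_
  have h' : ∑ i, |x i - y i| = 1 := h
  have := Finset.single_le_sum (f := fun i => |x i - y i|) (fun i _ => abs_nonneg _)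
    (Finset.mem_univ i)
  rw [abs_sub_comm]
  push_cast
  linarith

/-- The `2 d` unit vectors of `ℤ^d`. -/
def unitStep {d : ℕ} (p : Fin d × Bool) : Site d := Pi.single p.1 (if p.2 then 1 else -1)

theorem unitStep_not {d : ℕ} (p : Fin d × Bool) :
    unitStep (d := d) (p.1, !p.2) = -unitStep p := by
  obtain ⟨i, b⟩ := p
  cases b <;> simp [unitStep, ← Pi.single_neg]

theorem unitStep_injective {d : ℕ} : Function.Injective (unitStep (d := d)) := by
  rintro ⟨i, b⟩ ⟨j, c⟩ h
  have h1 := congrFun h i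
  by_cases hij : i = j
  · subst hij
    cases b <;> cases c <;> simp_all [unitStep]
  · cases b <;> simp [unitStep, hij] at h1

theorem adj_iff_exists_unitStep {d : ℕ} {x y : Site d} :
    (lattice d).Adj x y ↔ ∃ p, x + unitStep p = y := by
  constructor
  · intro h
    have h' : ∑ i, |x i - y i| = 1 := h
    obtain ⟨i, -, hi⟩ := Finset.exists_ne_zero_of_sum_ne_zero (h'.symm ▸ one_ne_zero :
      ∑ i, |x i - y i| ≠ 0)
    rw [← Finset.add_sum_erase _ _ (Finset.mem_univ i)] at h'
    have hnn : 0 ≤ ∑ j ∈ Finset.univ.erase i, |x j - y j| :=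
      Finset.sum_nonneg fun _ _ => abs_nonneg _
    have hi0 : 0 ≤ |x i - y i| := abs_nonneg _
    have hi1 : |x i - y i| = 1 := by omega
    have hz : ∑ j ∈ Finset.univ.erase i, |x j - y j| = 0 := by omega
    rw [Finset.sum_eq_zero_iff_of_nonneg fun _ _ => abs_nonneg _] at hz
    have hz' : ∀ j, j ≠ i → x j = y j := fun j hj => by
      have := hz j (by simp [hj])
      rw [abs_eq_zero] at this
      omega
    rcases (abs_eq (by norm_num : (0 : ℤ) ≤ 1)).1 hi1 with h1 | h1
    · refine ⟨(i, false), funext fun j => ?_⟩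
      rcases eq_or_ne j i with rfl | hj
      · simp [unitStep]; omega
      · simp [unitStep, hj, hz' j hj]
    · refine ⟨(i, true), funext fun j => ?_⟩
      rcases eq_or_ne j i with rfl | hj
      · simp [unitStep]; omega
      · simp [unitStep, hj, hz' j hj]
  · rintro ⟨⟨i, b⟩, rfl⟩
    change ∑ j, |x j - (x + unitStep (i, b)) j| = 1
    rw [Finset.sum_eq_single i]
    · cases b <;> simp [unitStep]
    · intro j _ hj
      simp [unitStep, hj]
    · simp

/-- The transition operator of the walk is the average over the unit steps. -/
theorem tsum_srw_mul {d : ℕ} (x : Site d) (g : Site d → ℝ≥0∞) :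
    ∑' y, (srw d x y : ℝ≥0∞) * g y = ∑ p, ((1 / (2 * (d : ℝ≥0)) : ℝ≥0) : ℝ≥0∞) * g (x + unitStep p) := by
  classical
  have hinj : Function.Injective fun p : Fin d × Bool => x + unitStep p :=
    fun p q h => unitStep_injective (add_left_cancel h)
  rw [tsum_eq_sum (s := Finset.univ.image fun p : Fin d × Bool => x + unitStep p),
    Finset.sum_image fun p _ q _ h => hinj h]
  · refine Finset.sum_congr rfl fun p _ => ?_
    rw [srw, if_pos (adj_iff_exists_unitStep.2 ⟨p, rfl⟩)]
  · intro y hy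
    rw [srw, if_neg, ENNReal.coe_zero, zero_mul]
    rw [adj_iff_exists_unitStep]
    simpa using hy

theorem tsum_srw {d : ℕ} (hd : 0 < d) (x : Site d) : ∑' y, (srw d x y : ℝ≥0∞) = 1 := by
  have h := tsum_srw_mul x fun _ => 1
  simp only [mul_one] at h
  rw [h, Finset.sum_const, Finset.card_univ, Fintype.card_prod, Fintype.card_fin,
    Fintype.card_bool, ← ENNReal.coe_nsmul, ← ENNReal.coe_one, ENNReal.coe_inj, nsmul_eq_mul]
  have : (d : ℝ≥0) ≠ 0 := by exact_mod_cast hd.ne'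
  push_cast
  field_simp

/-- The average of a function over the neighbours of a vertex. -/
noncomputable def nbrAvg {d : ℕ} (g : Site d → ℝ) (x : Site d) : ℝ :=
  ∑ p, 1 / (2 * (d : ℝ)) * g (x + unitStep p)

theorem tsum_srw_mul_ofReal {d : ℕ} {g : Site d → ℝ} (hg : ∀ x, 0 ≤ g x) (x : Site d) :
    ∑' y, (srw d x y : ℝ≥0∞) * ENNReal.ofReal (g y) = ENNReal.ofReal (nbrAvg g x) := by
  rw [tsum_srw_mul, nbrAvg, ENNReal.ofReal_sum_of_nonneg fun p _ => mul_nonneg (by positivity) (hg _)]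
  refine Finset.sum_congr rfl fun p _ => ?_
  rw [ENNReal.ofReal_mul (by positivity)]
  congr 1
  rw [← ENNReal.ofReal_coe_nnreal]
  push_cast
  rfl

/-! ### Sums over paths -/

/-- The weight of the path `x, l₁, …, lₖ, y`. -/
noncomputable def pathWeight (d : ℕ) : Site d → List (Site d) → Site d → ℝ≥0
  | x, [], y => srw d x y
  | x, z :: l, y => srw d x z * pathWeight d z l y

theorem pathWeight_append {d : ℕ} (x z y : Site d) (l l' : List (Site d)) :
    pathWeight d x (l ++ z :: l') y = pathWeight d x l z * pathWeight d z l' y := by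
  induction l generalizing x with
  | nil => rfl
  | cons a l ih => simp [pathWeight, ih, mul_assoc]

theorem pathWeight_eq_prod_zipWith {d : ℕ} (x y : Site d) (l : List (Site d)) :
    pathWeight d x l y = (List.zipWith (srw d) (x :: l) (l ++ [y])).prod := by
  induction l generalizing x with
  | nil => simp [pathWeight]
  | cons a l ih => simp [pathWeight, ih]

open Classical in
/-- The sum of `pathWeight x l z * f z` over all end points `z` and all paths `x, l, z` whose
intermediate vertices `l` lie in `I`. -/
noncomputable def pathSum {d : ℕ} (I : Set (Site d)) (f : Site d → ℝ≥0∞) (x : Site d) : ℝ≥0∞ :=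
  ∑' l : List (Site d), if ∀ y ∈ l, y ∈ I then ∑' z, (pathWeight d x l z : ℝ≥0∞) * f z else 0

theorem tsum_list {α : Type*} (F : List α → ℝ≥0∞) :
    ∑' l, F l = F [] + ∑' a, ∑' l, F (a :: l) := by
  classical
  rw [ENNReal.tsum_eq_add_tsum_ite [], ← ENNReal.tsum_prod]
  congr 1
  have hinj : Function.Injective fun p : α × List α => p.1 :: p.2 := by
    rintro ⟨a, l⟩ ⟨b, l'⟩ h
    simpa using h
  rw [← hinj.tsum_eq]
  · simp
  · intro l hl
    cases l with
    | nil => simp at hl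
    | cons a l => exact ⟨(a, l), rfl⟩

/-- First-step decomposition. The empty list is the one-step path, so the path of length zero is
never counted. -/
theorem pathSum_eq {d : ℕ} (I : Set (Site d)) (f : Site d → ℝ≥0∞) (x : Site d) :
    pathSum I f x = ∑' y, (srw d x y : ℝ≥0∞) * (f y + I.indicator (pathSum I f) y) := by
  classical
  rw [pathSum, tsum_list]
  simp only [mul_add, ENNReal.tsum_add]
  congr 1
  refine tsum_congr fun y => ?_
  by_cases hy : y ∈ I
  · rw [Set.indicator_of_mem hy, pathSum, ← ENNReal.tsum_mul_left]
    refine tsum_congr fun l => ?_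
    by_cases hl : ∀ z ∈ l, z ∈ I
    · rw [if_pos (by simpa [hy] using hl), if_pos hl, ← ENNReal.tsum_mul_left]
      simp [pathWeight, mul_assoc]
    · rw [if_neg (by simpa [hy] using hl), if_neg hl, mul_zero]
  · simp [hy]

open Classical in
/-- Minimum principle: a supersolution dominates the sum over paths. -/
theorem pathSum_le_of_supersolution {d : ℕ} {I : Set (Site d)} {f Φ : Site d → ℝ≥0∞}
    (h : ∀ x ∈ I, ∑' y, (srw d x y : ℝ≥0∞) * (f y + I.indicator Φ y) ≤ Φ x) {x : Site d} (hx : x ∈ I) :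
    pathSum I f x ≤ Φ x := by
  -- Truncating by path length permits induction without knowing in advance that the full sum is
  -- finite.
  have key : ∀ (N : ℕ) (x : Site d), x ∈ I → ∑' l : List (Site d), (if l.length < N then
      (if ∀ y ∈ l, y ∈ I then ∑' z, (pathWeight d x l z : ℝ≥0∞) * f z else 0) else 0) ≤ Φ x := by
    intro N
    induction N with
    | zero => intro x _; simp
    | succ N ih =>
      intro x hx
      refine le_trans ?_ (h x hx)
      rw [tsum_list]
      simp only [mul_add, ENNReal.tsum_add]
      gcongr with y
      · simp [pathWeight]
      · by_cases hy : y ∈ I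
        · rw [Set.indicator_of_mem hy]
          refine le_trans ?_ (mul_le_mul_right (ih y hy) _)
          rw [← ENNReal.tsum_mul_left]
          refine ENNReal.tsum_le_tsum fun l => ?_
          simp only [List.length_cons, Nat.add_lt_add_iff_right, List.forall_mem_cons, hy,
            true_and, mul_ite, mul_zero]
          rw [← ENNReal.tsum_mul_left]
          simp [pathWeight, mul_assoc]
        · simp [hy]
  rw [pathSum, ENNReal.tsum_eq_iSup_sum]
  refine iSup_le fun s => ?_
  refine le_trans ?_ (key (s.sup List.length + 1) x hx)
  refine le_trans (Finset.sum_le_sum fun l hl => ?_) (ENNReal.sum_le_tsum s)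
  rw [if_pos (Nat.lt_succ_of_le (Finset.le_sup (f := List.length) hl))]

/-! ### A superharmonic function and the Green function bound -/

/-- Fourth order bound for the even part of `y ↦ (1 + y) ^ (-s)`. -/
theorem exists_rpow_even_bound (s : ℝ) : ∃ C > 0, ∃ ε > 0, ∀ y : ℝ, |y| < ε →
    (1 + y) ^ (-s) + (1 - y) ^ (-s) ≤ 2 + s * (s + 1) * y ^ 2 + C * y ^ 4 := by
  have h2 : Ring.choose (-s) 2 = s * (s + 1) / 2 := by
    have := Ring.descPochhammer_eq_factorial_smul_choose (-s) 2
    simp [descPochhammer, Polynomial.smeval_mul, Polynomial.smeval_sub] at this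
    linarith
  have hO := (Real.one_add_rpow_hasFPowerSeriesAt_zero (a := -s)).isBigO_sub_partialSum_pow 4
  obtain ⟨C, hC, hb⟩ := hO.exists_pos
  rw [Asymptotics.isBigOWith_iff, Metric.eventually_nhds_iff] at hb
  obtain ⟨ε, hε, hb⟩ := hb
  refine ⟨2 * C, by positivity, ε, hε, fun y hy => ?_⟩
  have h1 := hb (y := y) (by simpa using hy)
  have h3 := hb (y := -y) (by simpa using hy)
  simp only [FormalMultilinearSeries.partialSum, Finset.sum_range_succ, binomialSeries_apply,
    Finset.sum_range_zero, List.prod_ofFn, Finset.prod_const, Finset.card_univ, Fintype.card_fin,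
    smul_eq_mul, h2, Ring.choose_zero_right, Ring.choose_one_right, Real.norm_eq_abs, zero_add,
    abs_neg, abs_abs, abs_pow] at h1 h3
  have e4 : |y| ^ 4 = y ^ 4 := (by decide : Even 4).pow_abs y
  rw [e4] at h1 h3
  have a1 := (abs_le.1 h1).2
  have a3 := (abs_le.1 h3).2
  rw [← sub_eq_add_neg] at a3
  -- In the sum of the two expansions the odd terms cancel, so the cubic coefficient need not be
  -- evaluated.
  nlinarith [a1, a3]

/-- The squared Euclidean distance. -/
def sqDist {d : ℕ} (x₀ x : Site d) : ℝ := ∑ i, ((x i - x₀ i : ℤ) : ℝ) ^ 2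

theorem sqDist_nonneg {d : ℕ} (x₀ x : Site d) : 0 ≤ sqDist x₀ x :=
  Finset.sum_nonneg fun _ _ => sq_nonneg _

theorem sqDist_add_unitStep {d : ℕ} (x₀ x : Site d) (p : Fin d × Bool) :
    sqDist x₀ (x + unitStep p) =
      sqDist x₀ x + 1 + (if p.2 then 1 else -1) * (2 * ((x p.1 - x₀ p.1 : ℤ) : ℝ)) := by
  obtain ⟨i, b⟩ := p
  rw [sqDist, sqDist, ← Finset.add_sum_erase _ _ (Finset.mem_univ i),
    ← Finset.add_sum_erase _ _ (Finset.mem_univ i)]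
  have : ∀ j ∈ Finset.univ.erase i, (((x + unitStep (i, b)) j - x₀ j : ℤ) : ℝ) ^ 2 =
      ((x j - x₀ j : ℤ) : ℝ) ^ 2 := fun j hj => by
    simp [unitStep, Finset.ne_of_mem_erase hj]
  rw [Finset.sum_congr rfl this]
  cases b <;> simp [unitStep] <;> ring

theorem sq_rad_le_sqDist {d : ℕ} (hd : 0 < d) (x₀ x : Site d) : (rad x₀ x : ℝ) ^ 2 ≤ sqDist x₀ x := by
  obtain ⟨i, hi⟩ := exists_abs_sub_eq_rad hd x₀ x
  have h : (rad x₀ x : ℝ) = |((x i - x₀ i : ℤ) : ℝ)| := by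
    rw [← Int.cast_abs, hi]; simp
  rw [h, sq_abs]
  exact Finset.single_le_sum (f := fun i => ((x i - x₀ i : ℤ) : ℝ) ^ 2) (fun _ _ => sq_nonneg _)
    (Finset.mem_univ i)

theorem sqDist_le {d : ℕ} (x₀ x : Site d) : sqDist x₀ x ≤ d * (rad x₀ x : ℝ) ^ 2 := by
  refine (Finset.sum_le_card_nsmul _ _ ((rad x₀ x : ℝ) ^ 2) fun i _ => ?_).trans (by simp)
  rw [← sq_abs]
  refine pow_le_pow_left₀ (abs_nonneg _) ?_ 2
  exact_mod_cast abs_sub_le_rad x₀ x i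

/-- Follows from log(1 - t) ≤ -t and 1 + z ≤ exp z. It bounds the central value from below in the
superharmonicity computation. -/
theorem one_add_mul_le_rpow_neg {s t : ℝ} (hs : 0 ≤ s) (ht : t < 1) :
    1 + s * t ≤ (1 - t) ^ (-s) := by
  rw [Real.rpow_def_of_pos (by linarith)]
  have h1 := Real.log_le_sub_one_of_pos (show 0 < 1 - t by linarith)
  have h2 := Real.add_one_le_exp (Real.log (1 - t) * -s)
  nlinarith

theorem nbrAvg_eq_sum {d : ℕ} (g : Site d → ℝ) (x : Site d) :
    nbrAvg g x = 1 / (2 * (d : ℝ)) * ∑ i, (g (x + unitStep (i, true)) + g (x + unitStep (i, false))) := by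
  rw [nbrAvg, ← Finset.mul_sum, Fintype.sum_prod_type]
  simp

/-- For large `a` the function `(‖x‖² + a) ^ (-(d - 2) / 2)` is superharmonic. -/
theorem exists_superharmonic {d : ℕ} (hd : 3 ≤ d) : ∃ a : ℝ, 1 ≤ a ∧ ∀ x₀ x : Site d,
    nbrAvg (fun y => (sqDist x₀ y + a) ^ (-(((d : ℝ) - 2) / 2))) x ≤
      (sqDist x₀ x + a) ^ (-(((d : ℝ) - 2) / 2)) := by
  set s : ℝ := ((d : ℝ) - 2) / 2 with hs
  have hd' : (3 : ℝ) ≤ d := by exact_mod_cast hd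
  have hs0 : 0 < s := by rw [hs]; linarith
  obtain ⟨C, hC, ε, hε, hT⟩ := exists_rpow_even_bound s
  -- The first two bounds keep the relative increments `y i` below 1 and ε; the third absorbs the
  -- quartic error.
  obtain ⟨a, ha⟩ : ∃ a : ℝ, a ≥ 4 ∧ a ≥ 4 / ε ^ 2 ∧ a ≥ 8 * C / (d * s) :=
    ⟨max 4 (max (4 / ε ^ 2) (8 * C / (d * s))), by simp⟩
  obtain ⟨ha1, ha2, ha3⟩ := ha
  refine ⟨a, by linarith, fun x₀ x => ?_⟩
  have hq := sqDist_nonneg x₀ x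
  set q := sqDist x₀ x with hqdef
  -- Centring at `v` turns the values at opposite neighbours into v(1 ± y i), so that the even
  -- expansion applies.
  set v : ℝ := q + a + 1 with hv
  have hv0 : 0 < v := by positivity
  have hva : a < v := by linarith
  set y : Fin d → ℝ := fun i => 2 * ((x i - x₀ i : ℤ) : ℝ) / v with hy
  have hysum : ∑ i, y i ^ 2 = 4 * q / v ^ 2 := by
    simp only [hy, hqdef, sqDist, div_pow, mul_pow, ← Finset.sum_div, ← Finset.mul_sum]
    norm_num
  have hy2 : ∀ i, y i ^ 2 ≤ 4 / v := fun i => by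
    refine (Finset.single_le_sum (f := fun i => y i ^ 2) (fun _ _ => sq_nonneg _)
      (Finset.mem_univ i)).trans ?_
    rw [hysum, div_le_div_iff₀ (by positivity) hv0]
    nlinarith
  have hyε : ∀ i, |y i| < ε := fun i => by
    refine abs_lt_of_sq_lt_sq ((hy2 i).trans_lt ?_) hε.le
    rw [div_lt_iff₀ hv0]
    have : 4 / ε ^ 2 < v := lt_of_le_of_lt ha2 hva
    rw [div_lt_iff₀ (by positivity)] at this
    linarith
  have hy1 : ∀ i, |y i| < 1 := fun i => by
    refine abs_lt_of_sq_lt_sq ((hy2 i).trans_lt ?_) zero_le_one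
    rw [div_lt_iff₀ hv0]
    linarith
  have hstep : ∀ i, (sqDist x₀ (x + unitStep (i, true)) + a) ^ (-s) +
      (sqDist x₀ (x + unitStep (i, false)) + a) ^ (-s) ≤
      v ^ (-s) * (2 + s * (s + 1) * y i ^ 2 + C * (4 / v * y i ^ 2)) := fun i => by
    have hi := abs_lt.1 (hy1 i)
    have e : v * y i = 2 * ((x i - x₀ i : ℤ) : ℝ) := by simp only [hy]; field_simp
    have e1 : sqDist x₀ (x + unitStep (i, true)) + a = v * (1 + y i) := by
      rw [sqDist_add_unitStep, mul_add, e, hv]; simp; ring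
    have e2 : sqDist x₀ (x + unitStep (i, false)) + a = v * (1 - y i) := by
      rw [sqDist_add_unitStep, mul_sub, e, hv]; simp; ring
    rw [e1, e2, Real.mul_rpow hv0.le (by linarith), Real.mul_rpow hv0.le (by linarith), ← mul_add]
    refine mul_le_mul_of_nonneg_left ((hT _ (hyε i)).trans ?_) (by positivity)
    have : y i ^ 4 ≤ 4 / v * y i ^ 2 := by
      have := mul_le_mul_of_nonneg_right (hy2 i) (sq_nonneg (y i))
      calc y i ^ 4 = y i ^ 2 * y i ^ 2 := by ring
        _ ≤ _ := this
    nlinarith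
  rw [nbrAvg_eq_sum]
  have e0 : q + a = v * (1 - 1 / v) := by rw [mul_sub, mul_one_div_cancel hv0.ne', hv]; ring
  have hv1 : 1 / v < 1 := by rw [div_lt_one hv0]; linarith
  have hB := one_add_mul_le_rpow_neg hs0.le hv1
  rw [e0, Real.mul_rpow hv0.le (by linarith)]
  calc _ ≤ 1 / (2 * (d : ℝ)) * ∑ i, v ^ (-s) * (2 + s * (s + 1) * y i ^ 2 + C * (4 / v * y i ^ 2)) :=
        mul_le_mul_of_nonneg_left (Finset.sum_le_sum fun i _ => hstep i) (by positivity)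
    _ = v ^ (-s) * (1 / (2 * (d : ℝ)) * (2 * d + s * (s + 1) * (4 * q / v ^ 2)
          + C * (4 / v * (4 * q / v ^ 2)))) := by
        rw [← Finset.mul_sum, Finset.sum_add_distrib, Finset.sum_add_distrib, ← Finset.mul_sum,
          ← Finset.mul_sum, ← Finset.mul_sum, hysum]
        simp
        ring
    _ ≤ v ^ (-s) * (1 + s * (1 / v)) := by
        refine mul_le_mul_of_nonneg_left ?_ (by positivity)
        -- This is where the exponent is critical: the second-order term becomes sq/v², leaving the
        -- margin s(a + 1)/v² below s/v to pay for the quartic error.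
        have hsd : s + 1 = d / 2 := by rw [hs]; ring
        have h8 : 8 * C ≤ s * d * a := by
          rw [ge_iff_le, div_le_iff₀ (by positivity)] at ha3
          linarith
        have : 1 + s * (1 / v) - 1 / (2 * (d : ℝ)) * (2 * d + s * (s + 1) * (4 * q / v ^ 2)
          + C * (4 / v * (4 * q / v ^ 2))) = (s * d * (v - q) * v - 8 * C * q) / (d * v ^ 3) := by
          rw [hsd]; field_simp; ring
        have h9 : 0 ≤ (s * d * (v - q) * v - 8 * C * q) / (d * v ^ 3) := by
          apply div_nonneg _ (by positivity)
          have hvq : v - q = a + 1 := by rw [hv]; ring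
          have hqv : q ≤ v := by linarith
          rw [hvq]
          have h10 : 8 * C * q ≤ s * d * a * v := mul_le_mul h8 hqv hq (by positivity)
          nlinarith [mul_pos (mul_pos hs0 (by linarith : (0:ℝ) < d)) hv0]
        linarith
    _ ≤ _ := mul_le_mul_of_nonneg_left hB (by positivity)

/-- Since `pathSum` omits the path of length zero, the supersolution to use is the one-step average
of `Ψ`, which lies below `Ψ`. -/
theorem pathSum_univ_single_le {d : ℕ} {x₀ : Site d} {Ψ : Site d → ℝ≥0∞}
    (h : ∀ x, (Pi.single x₀ 1 : Site d → ℝ≥0∞) x + ∑' y, (srw d x y : ℝ≥0∞) * Ψ y ≤ Ψ x) (x : Site d) :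
    pathSum Set.univ (Pi.single x₀ 1) x ≤ Ψ x := by
  refine (pathSum_le_of_supersolution (Φ := fun x => ∑' y, (srw d x y : ℝ≥0∞) * Ψ y) ?_
    (Set.mem_univ x)).trans (le_trans le_add_self (h x))
  intro x _
  simp only [Set.indicator_univ]
  exact ENNReal.tsum_le_tsum fun y => mul_le_mul_right (h y) _

/-- The Green function is bounded, and decays as the distance to the power `2 - d`. -/
theorem exists_green_bound {d : ℕ} (hd : 3 ≤ d) : ∃ K : ℝ≥0, ∀ x₀ x : Site d,
    pathSum Set.univ (Pi.single x₀ 1) x ≤ K ∧ ∀ r : ℕ, 1 ≤ r → r ≤ rad x₀ x →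
      pathSum Set.univ (Pi.single x₀ 1) x ≤ (K * ((r : ℝ≥0)⁻¹) ^ (d - 2) : ℝ≥0) := by
  obtain ⟨a, ha, hφ⟩ := exists_superharmonic hd
  set s : ℝ := ((d : ℝ) - 2) / 2 with hs
  have hd' : (3 : ℝ) ≤ d := by exact_mod_cast hd
  have hs0 : 0 < s := by rw [hs]; linarith
  have ha0 : 0 < a := by linarith
  -- All neighbours of the pole have squared distance 1, so δ is exactly the drop of the potential
  -- there; dividing by δ produces the unit source.
  set δ : ℝ := a ^ (-s) - (a + 1) ^ (-s) with hδ
  have hδ0 : 0 < δ := sub_pos.2 (Real.rpow_lt_rpow_of_neg ha0 (by linarith) (by linarith))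
  have key : ∀ x₀ x : Site d, pathSum Set.univ (Pi.single x₀ 1) x ≤
      ENNReal.ofReal (δ⁻¹ * (sqDist x₀ x + a) ^ (-s)) := by
    intro x₀ x
    have hpos : ∀ y, 0 ≤ δ⁻¹ * (sqDist x₀ y + a) ^ (-s) := fun y => by
      have := sqDist_nonneg x₀ y
      positivity
    refine pathSum_univ_single_le
      (Ψ := fun y => ENNReal.ofReal (δ⁻¹ * (sqDist x₀ y + a) ^ (-s))) (fun y => ?_) x
    rw [tsum_srw_mul_ofReal hpos]
    have e : nbrAvg (fun y => δ⁻¹ * (sqDist x₀ y + a) ^ (-s)) y =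
        δ⁻¹ * nbrAvg (fun y => (sqDist x₀ y + a) ^ (-s)) y := by
      simp only [nbrAvg, Finset.mul_sum]
      exact Finset.sum_congr rfl fun _ _ => by ring
    have hn : 0 ≤ nbrAvg (fun y => δ⁻¹ * (sqDist x₀ y + a) ^ (-s)) y :=
      Finset.sum_nonneg fun p _ => mul_nonneg (by positivity) (hpos _)
    rcases eq_or_ne y x₀ with rfl | hy
    · rw [Pi.single_eq_same, ← ENNReal.ofReal_one, ← ENNReal.ofReal_add zero_le_one hn]
      refine ENNReal.ofReal_le_ofReal ?_
      have e1 : nbrAvg (fun z => (sqDist y z + a) ^ (-s)) y = (a + 1) ^ (-s) := by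
        have : ∀ p, sqDist y (y + unitStep p) + a = a + 1 := fun p => by
          rw [sqDist_add_unitStep]; simp [sqDist]; ring
        simp only [nbrAvg, this, Finset.sum_const, Finset.card_univ, Fintype.card_prod,
          Fintype.card_fin, Fintype.card_bool, nsmul_eq_mul]
        push_cast
        field_simp
      rw [e, e1]
      have e2 : sqDist y y = 0 := by simp [sqDist]
      rw [e2, zero_add]
      have : δ⁻¹ * δ = 1 := inv_mul_cancel₀ hδ0.ne'
      rw [hδ] at this ⊢
      linarith
    · rw [Pi.single_eq_of_ne hy, zero_add, e]
      exact ENNReal.ofReal_le_ofReal (mul_le_mul_of_nonneg_left (hφ _ _) (by positivity))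
  refine ⟨Real.toNNReal δ⁻¹, fun x₀ x => ⟨(key x₀ x).trans ?_, fun r hr hrx => (key x₀ x).trans ?_⟩⟩
  · rw [← ENNReal.ofReal]
    refine ENNReal.ofReal_le_ofReal (mul_le_of_le_one_right (by positivity) ?_)
    exact Real.rpow_le_one_of_one_le_of_nonpos (by linarith [sqDist_nonneg x₀ x]) (by linarith)
  · have hr0 : (0 : ℝ) < r := by exact_mod_cast hr
    have : (Real.toNNReal δ⁻¹ * ((r : ℝ≥0)⁻¹) ^ (d - 2) : ℝ≥0) =
        Real.toNNReal (δ⁻¹ * ((r : ℝ)⁻¹) ^ (d - 2)) := by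
      rw [Real.toNNReal_mul (by positivity), Real.toNNReal_pow (by positivity), Real.toNNReal_inv,
        Real.toNNReal_inv, Real.toNNReal_natCast]
    rw [this, ← ENNReal.ofReal]
    refine ENNReal.ofReal_le_ofReal (mul_le_mul_of_nonneg_left ?_ (by positivity))
    have h1 : (r : ℝ) ^ 2 ≤ sqDist x₀ x + a := by
      have := sq_rad_le_sqDist (by omega) x₀ x
      have h2 : (r : ℝ) ≤ rad x₀ x := by exact_mod_cast hrx
      nlinarith
    refine (Real.rpow_le_rpow_of_nonpos (by positivity) h1 (by linarith)).trans (le_of_eq ?_)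
    rw [← Real.rpow_natCast, ← Real.rpow_mul hr0.le, inv_pow, ← Real.rpow_natCast r (d - 2),
      ← Real.rpow_neg hr0.le, Nat.cast_sub (by omega)]
    congr 1
    rw [hs]
    push_cast
    ring

/-! ### The capacity bound -/

/-- The vertices at sup-norm distance at most `n` from `x₀`. -/
noncomputable def ballFinset {d : ℕ} (x₀ : Site d) (n : ℕ) : Finset (Site d) :=
  Fintype.piFinset fun i => Finset.Icc (x₀ i - n) (x₀ i + n)

@[simp] theorem mem_ballFinset {d : ℕ} {x₀ x : Site d} {n : ℕ} :
    x ∈ ballFinset x₀ n ↔ rad x₀ x ≤ n := by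
  simp only [ballFinset, Fintype.mem_piFinset, Finset.mem_Icc, rad_le_iff, abs_le]
  exact forall_congr' fun i => by omega

theorem card_ballFinset {d : ℕ} (x₀ : Site d) (n : ℕ) :
    (ballFinset x₀ n).card = (2 * n + 1) ^ d := by
  rw [ballFinset, Fintype.card_piFinset]
  have : ∀ i, (Finset.Icc (x₀ i - n) (x₀ i + n)).card = 2 * n + 1 := fun i => by
    rw [Int.card_Icc]; omega
  simp [this]

theorem nbrAvg_const_sub {d : ℕ} (hd : 0 < d) (c : ℝ) (g : Site d → ℝ) (x : Site d) :
    nbrAvg (fun y => c - g y) x = c - nbrAvg g x := by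
  have : (d : ℝ) ≠ 0 := by exact_mod_cast hd.ne'
  simp only [nbrAvg, mul_sub, Finset.sum_sub_distrib]
  congr 1
  simp
  field_simp

theorem nbrAvg_sqDist {d : ℕ} (hd : 0 < d) (x₀ x : Site d) :
    nbrAvg (sqDist x₀) x = sqDist x₀ x + 1 := by
  have : (d : ℝ) ≠ 0 := by exact_mod_cast hd.ne'
  rw [nbrAvg_eq_sum]
  have : ∀ i : Fin d, sqDist x₀ (x + unitStep (i, true)) + sqDist x₀ (x + unitStep (i, false)) =
      2 * (sqDist x₀ x + 1) := fun i => by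
    rw [sqDist_add_unitStep, sqDist_add_unitStep]; simp; ring
  simp only [this]
  simp
  field_simp

/-- Summation by parts for the transition operator. -/
theorem tsum_mul_nbrAvg {d : ℕ} (f : Site d → ℝ) {u : Site d → ℝ} (hu : u.support.Finite) :
    Summable (fun x => f x * nbrAvg u x) ∧
      ∑' x, f x * nbrAvg u x = ∑' x, nbrAvg f x * u x := by
  have hs : ∀ g : Site d → ℝ, Summable fun x => g x * u x := fun g =>
    summable_of_hasFiniteSupport (hu.subset fun x hx => by
      simp only [Function.mem_support, ne_eq] at hx ⊢
      exact fun h => hx (by rw [h, mul_zero]))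
  have hs' : ∀ p : Fin d × Bool, Summable fun x => f x * (1 / (2 * (d : ℝ)) * u (x + unitStep p)) := fun p => by
    rw [← (Equiv.addRight (unitStep p)).symm.summable_iff]
    refine (hs fun x => f (x - unitStep p) * (1 / (2 * (d : ℝ)))).congr fun x => ?_
    simp [sub_eq_add_neg]
    ring
  simp only [nbrAvg, Finset.mul_sum, Finset.sum_mul]
  refine ⟨summable_sum fun p _ => hs' p, ?_⟩
  rw [Summable.tsum_finsetSum fun p _ => hs' p, Summable.tsum_finsetSum fun p _ => hs _]
  refine Finset.sum_nbij' (fun p => (p.1, !p.2)) (fun p => (p.1, !p.2)) (by simp) (by simp) (by simp)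
    (by simp) fun p _ => ?_
  rw [← (Equiv.addRight (unitStep p)).symm.tsum_eq]
  refine tsum_congr fun x => ?_
  rw [unitStep_not]
  simp
  ring

/-- The probability that the walk started at `x` hits `D` (after time `0`) before returning to `A`. -/
noncomputable def escape {d : ℕ} (A D : Set (Site d)) (x : Site d) : ℝ≥0∞ :=
  pathSum (A ∪ D)ᶜ (D.indicator 1) x

open Classical in
/-- The harmonic function with boundary values `0` on `A` and `1` on `D`. -/
noncomputable def escapeHarm {d : ℕ} (A D : Set (Site d)) (x : Site d) : ℝ≥0∞ :=
  if x ∈ D then 1 else if x ∈ A then 0 else escape A D x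

theorem escape_eq {d : ℕ} (A D : Set (Site d)) (x : Site d) :
    escape A D x = ∑' y, (srw d x y : ℝ≥0∞) * escapeHarm A D y := by
  rw [escape, pathSum_eq]
  refine tsum_congr fun y => ?_
  congr 1
  by_cases hD : y ∈ D
  · simp [escapeHarm, hD]
  · by_cases hA : y ∈ A <;> simp [escapeHarm, hD, hA, escape]

theorem escapeHarm_le_one {d : ℕ} (hd : 0 < d) (A D : Set (Site d)) (x : Site d) :
    escapeHarm A D x ≤ 1 := by
  by_cases hD : x ∈ D
  · simp [escapeHarm, hD]
  by_cases hA : x ∈ A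
  · simp [escapeHarm, hD, hA]
  rw [escapeHarm, if_neg hD, if_neg hA]
  refine pathSum_le_of_supersolution (Φ := fun _ => 1) (fun x _ => ?_) (by simp [hA, hD])
  refine (ENNReal.tsum_le_tsum fun y => mul_le_of_le_one_right' ?_).trans (tsum_srw hd x).le
  by_cases hD : y ∈ D
  · simp [hD]
  · by_cases hA : y ∈ A <;> simp [hD, hA]

theorem escape_le_one {d : ℕ} (hd : 0 < d) (A D : Set (Site d)) (x : Site d) :
    escape A D x ≤ 1 := by
  rw [escape_eq, ← tsum_srw hd x]
  exact ENNReal.tsum_le_tsum fun y => mul_le_of_le_one_right' (escapeHarm_le_one hd A D y)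

/-- The escape probability decreases when the target shrinks. -/
theorem escape_anti {d : ℕ} (hd : 0 < d) {A D D' : Set (Site d)} (hD : D ⊆ D')
    (x : Site d) : escape A D x ≤ escape A D' x := by
  -- The harmonic function for the larger target is a supersolution of the problem with the smaller
  -- one.
  have key : ∀ y, D.indicator 1 y + (A ∪ D)ᶜ.indicator (escapeHarm A D') y ≤ escapeHarm A D' y := by
    intro y
    by_cases hy : y ∈ D
    · simp [hy, escapeHarm, hD hy]
    · by_cases hA : y ∈ A <;> simp [hy, hA]
  have h1 : ∀ y ∈ (A ∪ D)ᶜ, pathSum (A ∪ D)ᶜ (D.indicator 1) y ≤ escapeHarm A D' y := by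
    refine fun y => pathSum_le_of_supersolution fun z hz => ?_
    refine (ENNReal.tsum_le_tsum fun y => mul_le_mul_right (key y) _).trans ?_
    rw [← escape_eq A D']
    by_cases hz' : z ∈ D'
    · rw [escapeHarm, if_pos hz']
      exact escape_le_one hd A D' z
    · rw [escapeHarm, if_neg hz', if_neg fun h => hz (Or.inl h)]
  rw [escape, pathSum_eq, escape_eq]
  refine ENNReal.tsum_le_tsum fun y => mul_le_mul_right (le_trans ?_ (key y)) _
  exact add_le_add le_rfl (Set.indicator_le_indicator' fun hy => h1 y hy)

/-- Capacity bound: the total escape probability from a ball of radius `n` is `O(n ^ (d - 2))`. -/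
theorem sum_escape_le {d : ℕ} (hd : 0 < d) (x₀ : Site d) {n : ℕ} (hn : 1 ≤ n) :
    (∑ x ∈ ballFinset x₀ n, escape {y | rad x₀ y ≤ n} {y | 2 * d * n ≤ rad x₀ y} x) * (n : ℝ≥0∞) ^ 2 ≤
      (4 * d * n : ℕ) ^ d := by
  set A : Set (Site d) := {y | rad x₀ y ≤ n} with hA
  set M : ℕ := 2 * d * n with hM
  set D : Set (Site d) := {y | M ≤ rad x₀ y} with hD
  have hnM : n < M := by rw [hM]; nlinarith
  have hdis : Disjoint A D := Set.disjoint_left.2 fun y h1 h2 => by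
    simp only [hA, hD, Set.mem_ofPred_eq] at h1 h2; omega
  set U : Site d → ℝ := fun x => (escapeHarm A D x).toReal with hU
  have hUtop : ∀ x, escapeHarm A D x ≠ ⊤ := fun x =>
    ((escapeHarm_le_one hd A D x).trans_lt ENNReal.one_lt_top).ne
  have hU0 : ∀ x, 0 ≤ U x := fun x => ENNReal.toReal_nonneg
  have hU1 : ∀ x, U x ≤ 1 := fun x => by
    simpa using ENNReal.toReal_mono ENNReal.one_ne_top (escapeHarm_le_one hd A D x)
  have hesc : ∀ x, escape A D x = ENNReal.ofReal (nbrAvg U x) := fun x => by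
    rw [escape_eq, ← tsum_srw_mul_ofReal hU0]
    simp only [hU, ENNReal.ofReal_toReal (hUtop _)]
  have hP0 : ∀ x, 0 ≤ nbrAvg U x := fun x =>
    Finset.sum_nonneg fun p _ => mul_nonneg (by positivity) (hU0 _)
  set u : Site d → ℝ := fun x => 1 - U x with hu
  have hPu : ∀ x, nbrAvg u x = 1 - nbrAvg U x := nbrAvg_const_sub hd 1 U
  have hu0 : ∀ x, 0 ≤ u x := fun x => sub_nonneg.2 (hU1 x)
  have hPu0 : ∀ x, 0 ≤ nbrAvg u x := fun x =>
    Finset.sum_nonneg fun p _ => mul_nonneg (by positivity) (hu0 _)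
  have huD : ∀ x, x ∉ ballFinset x₀ (M - 1) → u x = 0 := fun x hx => by
    have : x ∈ D := by simp only [mem_ballFinset] at hx; simp only [hD, Set.mem_ofPred_eq]; omega
    simp [hu, hU, escapeHarm, this]
  have hfin : u.support.Finite := (ballFinset x₀ (M - 1)).finite_toSet.subset fun x hx => by
    by_contra h
    exact hx (huD x h)
  -- The paraboloid loses exactly 1 under averaging, is at least n² on `A`, and is nonpositive on
  -- `D`.
  set f : Site d → ℝ := fun x => (M : ℝ) ^ 2 - sqDist x₀ x with hf
  have hPf : ∀ x, nbrAvg f x = f x - 1 := fun x => by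
    rw [hf, nbrAvg_const_sub hd, nbrAvg_sqDist hd]; ring
  obtain ⟨hs1, hparts⟩ := tsum_mul_nbrAvg f hfin
  have hsm : ∀ g : Site d → ℝ, Summable fun x => g x * u x := fun g =>
    summable_of_hasFiniteSupport (hfin.subset fun x hx => by
      simp only [Function.mem_support, ne_eq] at hx ⊢
      exact fun h => hx (by rw [h, mul_zero]))
  have hs2 : Summable fun x => f x * (u x - nbrAvg u x) := by
    simpa only [mul_sub] using (hsm f).sub hs1
  -- Moving the Laplacian onto `f` leaves the total mass of `u`, which is at most the number of
  -- points in the ball of radius M - 1.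
  have htot : ∑' x, f x * (u x - nbrAvg u x) = ∑' x, u x := by
    simp only [mul_sub]
    rw [(hsm f).tsum_sub hs1, hparts, ← (hsm f).tsum_sub (hsm _)]
    refine tsum_congr fun x => ?_
    rw [hPf]; ring
  have hA1 : ∀ x ∈ ballFinset x₀ n, nbrAvg U x * (n : ℝ) ^ 2 ≤ f x * (u x - nbrAvg u x) := by
    intro x hx
    rw [mem_ballFinset] at hx
    have hxA : x ∈ A := hx
    have hxD : x ∉ D := Set.disjoint_left.1 hdis hxA
    have hux : u x = 1 := by simp [hu, hU, escapeHarm, hxA, hxD]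
    rw [hux, hPu, sub_sub_cancel, mul_comm]
    refine mul_le_mul_of_nonneg_right ?_ (hP0 x)
    have h1 := sqDist_le x₀ x
    have h2 : (rad x₀ x : ℝ) ≤ n := by exact_mod_cast hx
    have h3 : (1 : ℝ) ≤ d := by exact_mod_cast hd
    have h4 : (d : ℝ) * (rad x₀ x : ℝ) ^ 2 ≤ d * (n : ℝ) ^ 2 := by gcongr
    have h5 : (M : ℝ) = 2 * d * n := by rw [hM]; push_cast; ring
    simp only [hf, h5]
    have h6 : (d : ℝ) ≤ d ^ 2 := by nlinarith
    have h7 : (0 : ℝ) ≤ (n : ℝ) ^ 2 := by positivity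
    nlinarith [mul_le_mul_of_nonneg_right h6 h7, mul_le_mul_of_nonneg_right h3 h7]
  -- On `D` both factors are nonpositive; between the two sets `u` is harmonic. Only the terms on
  -- `A` therefore matter for the upper bound.
  have hrest : ∀ x ∉ ballFinset x₀ n, 0 ≤ f x * (u x - nbrAvg u x) := by
    intro x hx
    have hxA : x ∉ A := fun h => hx (mem_ballFinset.2 h)
    by_cases hxD : x ∈ D
    · have hux : u x = 0 := by simp [hu, hU, escapeHarm, hxD]
      rw [hux]
      refine mul_nonneg_of_nonpos_of_nonpos ?_ (by linarith [hPu0 x])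
      have h1 := sq_rad_le_sqDist hd x₀ x
      have h2 : (M : ℝ) ≤ rad x₀ x := by exact_mod_cast hxD
      simp only [hf]
      nlinarith [Nat.cast_nonneg (α := ℝ) M]
    · have : U x = nbrAvg U x := by
        simp only [hU]
        rw [escapeHarm, if_neg hxD, if_neg hxA, hesc, ENNReal.toReal_ofReal (hP0 x)]
      rw [hPu, ← this]
      simp [hu]
  have hmain : (∑ x ∈ ballFinset x₀ n, nbrAvg U x) * (n : ℝ) ^ 2 ≤ ((4 * d * n : ℕ) : ℝ) ^ d := by
    rw [Finset.sum_mul]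
    refine (Finset.sum_le_sum hA1).trans ((hs2.sum_le_tsum _ hrest).trans ?_)
    rw [htot, tsum_eq_sum huD]
    refine (Finset.sum_le_card_nsmul _ _ 1 fun x _ => by simp only [hu]; linarith [hU0 x]).trans ?_
    rw [card_ballFinset, nsmul_eq_mul, mul_one]
    push_cast
    refine pow_le_pow_left₀ (by positivity) ?_ d
    have : 2 * (M - 1) + 1 ≤ 4 * d * n := by
      have : 4 * d * n = 2 * M := by rw [hM]; ring
      omega
    exact_mod_cast this
  simp only [hesc]
  rw [← ENNReal.ofReal_sum_of_nonneg fun x _ => hP0 x, ← ENNReal.ofReal_natCast n,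
    ← ENNReal.ofReal_pow (by positivity), ← ENNReal.ofReal_mul (Finset.sum_nonneg fun x _ => hP0 x)]
  refine (ENNReal.ofReal_le_ofReal hmain).trans ?_
  rw [ENNReal.ofReal_pow (by positivity), ENNReal.ofReal_natCast]

/-! ### The loop measure -/

/-- The loops that visit `A`. -/
def loopsHitting {d : ℕ} (A : Set (Site d)) : Set (Loop d) := {ℓ | ∃ x ∈ ℓ.1, x ∈ A}

/-- The loop measure `μ` of a set of loops. -/
noncomputable def loopMeasure {d : ℕ} (S : Set (Loop d)) : ℝ≥0∞ := ∑' ℓ : S, (loopMass d ℓ : ℝ≥0∞)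

theorem loopMeasure_mono {d : ℕ} {S T : Set (Loop d)} (h : S ⊆ T) : loopMeasure S ≤ loopMeasure T :=
  ENNReal.tsum_mono_subtype (fun ℓ => (loopMass d ℓ : ℝ≥0∞)) h

theorem loopMeasure_union_le {d : ℕ} (S T : Set (Loop d)) :
    loopMeasure (S ∪ T) ≤ loopMeasure S + loopMeasure T :=
  ENNReal.tsum_union_le (fun ℓ => (loopMass d ℓ : ℝ≥0∞)) S T

theorem loopMeasure_biUnion_le {d : ℕ} {ι : Type*} (s : Finset ι) (S : ι → Set (Loop d)) :
    loopMeasure (⋃ i ∈ s, S i) ≤ ∑ i ∈ s, loopMeasure (S i) :=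
  ENNReal.tsum_biUnion_le (fun ℓ => (loopMass d ℓ : ℝ≥0∞)) s S

/-- The mass of a loop is at most the product of the transition probabilities along it. -/
theorem loopMass_le_pathWeight {d : ℕ} {ℓ : Loop d} {x : Site d} {l : List (Site d)}
    (h : ((x :: l : List (Site d)) : Cycle (Site d)) = ℓ.1) : loopMass d ℓ ≤ pathWeight d x l x := by
  have hw : ∀ l' ∈ ℓ.1.lists.toFinset,
      basedWeight d l' = 1 / ((l.length + 1 : ℕ) : ℝ≥0) * pathWeight d x l x := by
    intro l' hl'
    rw [Multiset.mem_toFinset, Cycle.mem_lists_iff_coe_eq, ← h, Cycle.coe_eq_coe] at hl'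
    obtain ⟨k, rfl⟩ := hl'.symm
    rw [basedWeight, List.length_rotate, List.length_cons, List.rotate_rotate, add_comm k 1,
      ← List.rotate_rotate, ← List.zipWith_rotate_distrib _ _ _ _ (by simp),
      (List.rotate_perm _ _).prod_eq, pathWeight_eq_prod_zipWith]
    simp
  rw [loopMass, Finset.sum_congr rfl hw, Finset.sum_const, nsmul_eq_mul, ← mul_assoc]
  refine mul_le_of_le_one_left' ?_
  -- There are at most as many distinct rotations as vertices, which the factor 1/n in the based
  -- weight compensates.
  have hc : ℓ.1.lists.toFinset.card ≤ l.length + 1 := by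
    refine (Multiset.toFinset_card_le _).trans (le_of_eq ?_)
    rw [← h, Cycle.lists_coe, Multiset.coe_card, List.length_cyclicPermutations_cons]
  rw [mul_one_div]
  exact div_le_one_of_le₀ (by exact_mod_cast hc) (by positivity)

theorem exists_first_split {α : Type*} {p : α → Prop} {l : List α} (h : ∃ a ∈ l, p a) :
    ∃ l₁ a l₂, l = l₁ ++ a :: l₂ ∧ p a ∧ ∀ b ∈ l₁, ¬p b := by
  induction l with
  | nil => simp at h
  | cons c l ih =>
    by_cases hc : p c
    · exact ⟨[], c, l, rfl, hc, by simp⟩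
    · obtain ⟨a, ha, hpa⟩ := h
      rcases List.mem_cons.1 ha with rfl | ha
      · exact absurd hpa hc
      obtain ⟨l₁, a, l₂, rfl, h1, h2⟩ := ih ⟨a, ha, hpa⟩
      exact ⟨c :: l₁, a, l₂, rfl, h1, by simpa [hc] using h2⟩

theorem exists_last_split {α : Type*} {p : α → Prop} {l : List α} (h : ∃ a ∈ l, p a) :
    ∃ l₁ a l₂, l = l₁ ++ a :: l₂ ∧ p a ∧ ∀ b ∈ l₂, ¬p b := by
  obtain ⟨l₁, a, l₂, e, h1, h2⟩ := exists_first_split (p := p) (l := l.reverse) (by simpa using h)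
  refine ⟨l₂.reverse, a, l₁.reverse, ?_, h1, by simpa using h2⟩
  rw [← List.reverse_reverse l, e]
  simp

theorem exists_cons_coe_eq {α : Type*} {c : Cycle α} {x : α} (hx : x ∈ c) :
    ∃ l : List α, ((x :: l : List α) : Cycle α) = c := by
  induction c using Quotient.inductionOn with
  | _ l =>
    obtain ⟨s, t, rfl⟩ := List.append_of_mem (Cycle.mem_coe_iff.1 hx)
    exact ⟨t ++ s, Cycle.coe_eq_coe.2 (by simpa using List.isRotated_append (l := x :: t) (l' := s))⟩

/-- A loop visiting `A` and `D` can be rooted at a vertex of `A` from which it reaches `D` before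
returning to `A`. -/
theorem exists_excursion_root {d : ℕ} {A D : Set (Site d)} (h : Disjoint A D) {ℓ : Loop d}
    (hA : ℓ ∈ loopsHitting A) (hD : ℓ ∈ loopsHitting D) :
    ∃ x l₁ z l₂, ((x :: (l₁ ++ z :: l₂) : List (Site d)) : Cycle (Site d)) = ℓ.1 ∧ x ∈ A ∧ z ∈ D ∧
      ∀ y ∈ l₁, y ∈ (A ∪ D)ᶜ := by
  obtain ⟨b, hb, hbD⟩ := hD
  obtain ⟨a, ha, haA⟩ := hA
  obtain ⟨t, ht⟩ := exists_cons_coe_eq hb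
  rw [← ht, Cycle.mem_coe_iff, List.mem_cons] at ha
  have hat : a ∈ t := ha.resolve_left fun e => Set.disjoint_left.1 h haA (e ▸ hbD)
  -- Starting from `b` in `D`, the last visit `x` to `A` is the new root: after it the loop avoids
  -- `A` until it closes up at `b`, so its next visit to `D` ends the excursion.
  obtain ⟨t₁, x, t₂, rfl, hxA, ht₂⟩ := exists_last_split (p := (· ∈ A)) ⟨a, hat, haA⟩
  have hrot : ((x :: (t₂ ++ b :: t₁) : List (Site d)) : Cycle (Site d)) = ℓ.1 := by
    rw [← ht, Cycle.coe_eq_coe]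
    simpa using List.isRotated_append (l := x :: t₂) (l' := b :: t₁)
  by_cases h2 : ∃ z ∈ t₂, z ∈ D
  · obtain ⟨l₁, z, l₂, rfl, hzD, hl₁⟩ := exists_first_split h2
    refine ⟨x, l₁, z, l₂ ++ b :: t₁, by simpa using hrot, hxA, hzD, fun y hy => ?_⟩
    rintro (h' | h')
    · exact ht₂ y (by simp [hy]) h'
    · exact hl₁ y hy h'
  · refine ⟨x, t₂, b, t₁, hrot, hxA, hbD, fun y hy => ?_⟩
    rintro (h' | h')
    · exact ht₂ y hy h'
    · exact h2 ⟨y, hy, h'⟩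

theorem pathSum_univ_single {d : ℕ} (x z : Site d) :
    pathSum Set.univ (Pi.single x 1) z = ∑' l, (pathWeight d z l x : ℝ≥0∞) := by
  simp only [pathSum, Set.mem_univ, imp_true_iff, if_true]
  refine tsum_congr fun l => ?_
  rw [tsum_eq_single x fun y hy => by simp [Pi.single_eq_of_ne hy]]
  simp

open Classical in
/-- The measure of the loops visiting `A` and `D` is at most the total escape probability from `A` to
`D` times a bound on the Green function between `A` and `D`. -/
theorem loopMeasure_hitting_le {d : ℕ} {A : Finset (Site d)} {D : Set (Site d)}
    (h : Disjoint (A : Set (Site d)) D) {g : ℝ≥0∞}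
    (hg : ∀ x ∈ A, ∀ z ∈ D, pathSum Set.univ (Pi.single x 1) z ≤ g) :
    loopMeasure (loopsHitting (A : Set (Site d)) ∩ loopsHitting D) ≤ (∑ x ∈ A, escape A D x) * g := by
  set F : Site d × List (Site d) × Site d × List (Site d) → ℝ≥0∞ := fun q =>
    if q.1 ∈ A then if ∀ y ∈ q.2.1, y ∈ ((A : Set (Site d)) ∪ D)ᶜ then
      if q.2.2.1 ∈ D then (pathWeight d q.1 q.2.1 q.2.2.1 : ℝ≥0∞) * pathWeight d q.2.2.1 q.2.2.2 q.1
      else 0 else 0 else 0 with hF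
  have hroot : ∀ ℓ : ↥(loopsHitting (A : Set (Site d)) ∩ loopsHitting D),
      ∃ q : Site d × List (Site d) × Site d × List (Site d),
        ((q.1 :: (q.2.1 ++ q.2.2.1 :: q.2.2.2) : List (Site d)) : Cycle (Site d)) = ℓ.1.1 ∧
        (loopMass d ℓ : ℝ≥0∞) ≤ F q := by
    rintro ⟨ℓ, hA, hD⟩
    obtain ⟨x, l₁, z, l₂, he, hx, hz, hl⟩ := exists_excursion_root h hA hD
    refine ⟨(x, l₁, z, l₂), he, ?_⟩
    simp only [hF]
    rw [if_pos (by simpa using hx), if_pos hl, if_pos hz, ← ENNReal.coe_mul, ← pathWeight_append]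
    exact ENNReal.coe_le_coe.2 (loopMass_le_pathWeight he)
  choose q hq1 hq2 using hroot
  -- The decomposition determines the loop, so summing over all decompositions only overcounts.
  have hinj : Function.Injective q := fun a b hab => by
    apply Subtype.ext
    apply Subtype.ext
    rw [← hq1, ← hq1, hab]
  calc loopMeasure _ ≤ ∑' ℓ, F (q ℓ) := ENNReal.tsum_le_tsum hq2
    _ ≤ ∑' q, F q := ENNReal.tsum_comp_le_tsum_of_injective hinj F
    _ = ∑' x, ∑' l₁, ∑' z, ∑' l₂, F (x, l₁, z, l₂) := by
      simp only [ENNReal.tsum_prod']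
    _ ≤ ∑' x, if x ∈ A then escape A D x * g else 0 := by
      refine ENNReal.tsum_le_tsum fun x => ?_
      by_cases hx : x ∈ A
      · rw [if_pos hx, escape, pathSum, ← ENNReal.tsum_mul_right]
        refine ENNReal.tsum_le_tsum fun l₁ => ?_
        by_cases hl : ∀ y ∈ l₁, y ∈ ((A : Set (Site d)) ∪ D)ᶜ
        · rw [if_pos hl, ← ENNReal.tsum_mul_right]
          refine ENNReal.tsum_le_tsum fun z => ?_
          by_cases hz : z ∈ D
          · simp only [hF]
            simp only [if_pos hx, if_pos hl, if_pos hz, ENNReal.tsum_mul_left]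
            rw [Set.indicator_of_mem hz, Pi.one_apply, mul_one, ← pathSum_univ_single]
            exact mul_le_mul_right (hg x hx z hz) _
          · simp [hF, hz]
        · simp only [hF]
          simp only [if_neg hl, ite_self, tsum_zero, zero_le]
      · simp [hF, hx]
    _ = (∑ x ∈ A, escape A D x) * g := by
      rw [tsum_eq_sum (s := A) fun x hx => if_neg hx, Finset.sum_mul]
      exact Finset.sum_congr rfl fun x hx => if_pos hx

/-- The loops that visit a given vertex have bounded measure. -/
theorem loopMeasure_hitting_singleton_le {d : ℕ} (x : Site d) :
    loopMeasure (loopsHitting {x}) ≤ pathSum Set.univ (Pi.single x 1) x := by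
  have hroot : ∀ ℓ : ↥(loopsHitting ({x} : Set (Site d))),
      ∃ l : List (Site d), ((x :: l : List (Site d)) : Cycle (Site d)) = ℓ.1.1 := by
    rintro ⟨ℓ, y, hy, rfl⟩
    exact exists_cons_coe_eq hy
  choose q hq using hroot
  have hinj : Function.Injective q := fun a b hab => by
    apply Subtype.ext
    apply Subtype.ext
    rw [← hq, ← hq, hab]
  rw [pathSum_univ_single]
  refine le_trans (ENNReal.tsum_le_tsum fun ℓ => ?_)
    (ENNReal.tsum_comp_le_tsum_of_injective hinj fun l => (pathWeight d x l x : ℝ≥0∞))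
  exact ENNReal.coe_le_coe.2 (loopMass_le_pathWeight (hq ℓ))

/-- The loops that cross the annulus between radii `n` and `m`. -/
def loopsCrossing {d : ℕ} (x₀ : Site d) (n m : ℕ) : Set (Loop d) :=
  loopsHitting {x | rad x₀ x ≤ n} ∩ loopsHitting {x | m ≤ rad x₀ x}

/-- The loops crossing an annulus of radii `n` and `m ≥ 2 d n` have measure `O((n / m) ^ (d - 2))`, and
those visiting a vertex have bounded measure. -/
theorem exists_loopMeasure_bound {d : ℕ} (hd : 3 ≤ d) : ∃ C : ℝ≥0, 1 ≤ C ∧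
    (∀ x : Site d, loopMeasure (loopsHitting {x}) ≤ C) ∧
    ∀ (x₀ : Site d) (n m : ℕ), 1 ≤ n → 2 * d * n ≤ m →
      loopMeasure (loopsCrossing x₀ n m) ≤ (C * ((n : ℝ≥0) / m) ^ (d - 2) : ℝ≥0) := by
  obtain ⟨K, hK⟩ := exists_green_bound hd
  refine ⟨max 1 (max K ((4 * d) ^ d * K * 2 ^ (d - 2))), le_max_left _ _, fun x => ?_, ?_⟩
  · exact ((loopMeasure_hitting_singleton_le x).trans (hK x x).1).trans
      (ENNReal.coe_le_coe.2 ((le_max_left _ _).trans (le_max_right _ _)))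
  intro x₀ n m hn hm
  have hnm : 2 * n ≤ m := le_trans (by gcongr; omega) hm
  set r : ℕ := m - n with hr
  have hr1 : 1 ≤ r := by omega
  have hA : {x | rad x₀ x ≤ n} = (ballFinset x₀ n : Set (Site d)) := by ext; simp
  have hdis : Disjoint (ballFinset x₀ n : Set (Site d)) {x | m ≤ rad x₀ x} := by
    rw [← hA]
    exact Set.disjoint_left.2 fun y h1 h2 => by
      simp only [Set.mem_ofPred_eq] at h1 h2; omega
  rw [loopsCrossing, hA]
  refine (loopMeasure_hitting_le hdis (g := (K * ((r : ℝ≥0)⁻¹) ^ (d - 2) : ℝ≥0)) ?_).trans ?_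
  · intro x hx z hz
    refine (hK x z).2 r hr1 ?_
    rw [mem_ballFinset] at hx
    have h1 := rad_triangle x₀ x z
    have h2 : m ≤ rad x₀ z := hz
    omega
  have hE : (∑ x ∈ ballFinset x₀ n, escape (ballFinset x₀ n : Set (Site d)) {x | m ≤ rad x₀ x} x) ≤
      (((4 * d) ^ d * n ^ (d - 2) : ℝ≥0) : ℝ≥0∞) := by
    have h1 := sum_escape_le (d := d) (by omega) x₀ hn
    rw [hA] at h1
    -- The escape sum for outer radius 2dn also serves every larger `m`; all decay in `m` comes from
    -- the Green function.
    have h2 : (∑ x ∈ ballFinset x₀ n, escape (ballFinset x₀ n : Set (Site d)) {x | m ≤ rad x₀ x} x) ≤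
        ∑ x ∈ ballFinset x₀ n, escape (ballFinset x₀ n : Set (Site d)) {x | 2 * d * n ≤ rad x₀ x} x :=
      Finset.sum_le_sum fun x _ => escape_anti (by omega) (fun y hy => le_trans hm hy) x
    refine h2.trans ?_
    have hn0 : (n : ℝ≥0∞) ^ 2 ≠ 0 := by
      have : (n : ℝ≥0∞) ≠ 0 := by exact_mod_cast (by omega : n ≠ 0)
      positivity
    rw [← ENNReal.mul_le_mul_iff_left hn0 (by finiteness)]
    refine h1.trans (le_of_eq ?_)
    have : (n : ℝ≥0∞) ^ d = n ^ (d - 2) * n ^ 2 := by rw [← pow_add]; congr 1; omega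
    push_cast
    rw [mul_pow, this, mul_assoc]
  refine (mul_le_mul_left hE _).trans ?_
  rw [← ENNReal.coe_mul, ENNReal.coe_le_coe]
  have hm0 : (0 : ℝ≥0) < m := by exact_mod_cast (by omega : 0 < m)
  have hr0 : (0 : ℝ≥0) < r := by exact_mod_cast hr1
  have hrm : (r : ℝ≥0)⁻¹ ≤ 2 * (m : ℝ≥0)⁻¹ := by
    rw [← div_eq_mul_inv, inv_le_comm₀ hr0 (by positivity), inv_div, div_le_iff₀ (by norm_num)]
    exact_mod_cast (by omega : m ≤ r * 2)
  calc (4 * (d : ℝ≥0)) ^ d * (n : ℝ≥0) ^ (d - 2) * (K * ((r : ℝ≥0)⁻¹) ^ (d - 2))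
      ≤ (4 * (d : ℝ≥0)) ^ d * (n : ℝ≥0) ^ (d - 2) * (K * (2 * (m : ℝ≥0)⁻¹) ^ (d - 2)) := by gcongr
    _ = ((4 * d) ^ d * K * 2 ^ (d - 2)) * ((n : ℝ≥0) / m) ^ (d - 2) := by
      rw [div_eq_mul_inv, mul_pow, mul_pow]; ring
    _ ≤ _ := by
      gcongr
      exact (le_max_right _ _).trans (le_max_right _ _)

/-! ### The Poisson ensemble: presence of loops and independence -/

instance instIsProbabilityMeasureLoopLaw (d : ℕ) (α : ℝ≥0) : IsProbabilityMeasure (loopLaw d α) := by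
  unfold loopLaw; infer_instance

instance instCountableLoop (d : ℕ) : Countable (Loop d) := by
  have : Countable (Cycle (Site d)) := Quotient.countable
  infer_instance

/-- The event that some loop of `S` is present. -/
def presentIn {d : ℕ} (S : Set (Loop d)) : Set (Loop d → ℕ) := {ω | ∃ ℓ ∈ S, 1 ≤ ω ℓ}

theorem poissonMeasure_one_le (r : ℝ≥0) : poissonMeasure r {k | 1 ≤ k} ≤ r := by
  have h : {k : ℕ | 1 ≤ k} = {0}ᶜ := by ext k; simp; omega
  rw [h, prob_compl_eq_one_sub (measurableSet_singleton 0), poissonMeasure_singleton, tsub_le_iff_left]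
  have h1 := Real.add_one_le_exp (-(r : ℝ))
  rw [← ENNReal.ofReal_coe_nnreal, ← ENNReal.ofReal_add (by positivity) (by positivity),
    ← ENNReal.ofReal_one]
  refine ENNReal.ofReal_le_ofReal ?_
  simp
  linarith

theorem measurePreserving_eval_loopLaw {d : ℕ} (α : ℝ≥0) (ℓ : Loop d) :
    MeasurePreserving (fun ω : Loop d → ℕ => ω ℓ) (loopLaw d α) (poissonMeasure (α * loopMass d ℓ)) :=
  measurePreserving_eval_infinitePi _ ℓ

theorem loopLaw_presentIn_le {d : ℕ} (α : ℝ≥0) (S : Set (Loop d)) :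
    loopLaw d α (presentIn S) ≤ α * loopMeasure S := by
  have h : presentIn S = ⋃ ℓ : S, (fun ω : Loop d → ℕ => ω ℓ) ⁻¹' {k | 1 ≤ k} := by
    ext ω; simp [presentIn]
  rw [h, loopMeasure, ← ENNReal.tsum_mul_left]
  refine (measure_iUnion_le _).trans (ENNReal.tsum_le_tsum fun ℓ => ?_)
  rw [(measurePreserving_eval_loopLaw α ℓ.1).measure_preimage
    (MeasurableSet.of_discrete).nullMeasurableSet, ← ENNReal.coe_mul]
  exact poissonMeasure_one_le _

/-- The events that depend only on the loops in `S`. -/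
abbrev loopSigma {d : ℕ} (S : Set (Loop d)) : MeasurableSpace (Loop d → ℕ) :=
  ⨆ ℓ ∈ S, MeasurableSpace.comap (fun ω => ω ℓ) ⊤

theorem loopSigma_mono {d : ℕ} {S T : Set (Loop d)} (h : S ⊆ T) : loopSigma S ≤ loopSigma T :=
  biSup_mono fun _ hℓ => h hℓ

theorem measurable_eval_loopSigma {d : ℕ} {S : Set (Loop d)} {ℓ : Loop d} (h : ℓ ∈ S) :
    Measurable[loopSigma S] fun ω : Loop d → ℕ => ω ℓ :=
  measurable_iff_comap_le.2 (le_iSup₂ (f := fun ℓ (_ : ℓ ∈ S) =>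
    MeasurableSpace.comap (fun ω : Loop d → ℕ => ω ℓ) ⊤) ℓ h)

theorem measurable_indicator_loopSigma {d : ℕ} (S : Set (Loop d)) :
    Measurable[loopSigma S] fun ω : Loop d → ℕ => S.indicator ω := by
  refine @measurable_pi_lambda _ _ _ (loopSigma S) _ _ fun ℓ => ?_
  by_cases h : ℓ ∈ S
  · simpa [h] using measurable_eval_loopSigma h
  · simp [h]

theorem measurableSet_presentIn {d : ℕ} (S : Set (Loop d)) :
    MeasurableSet[loopSigma S] (presentIn S) := by
  have h : presentIn S = ⋃ ℓ : S, (fun ω : Loop d → ℕ => ω ℓ) ⁻¹' {k | 1 ≤ k} := by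
    ext ω; simp [presentIn]
  rw [h]
  exact MeasurableSet.iUnion fun ℓ => measurable_eval_loopSigma ℓ.2 MeasurableSet.of_discrete

theorem loopLaw_inter_eq {d : ℕ} (α : ℝ≥0) {S T : Set (Loop d)} (h : Disjoint S T)
    {E F : Set (Loop d → ℕ)} (hE : MeasurableSet[loopSigma S] E) (hF : MeasurableSet[loopSigma T] F) :
    loopLaw d α (E ∩ F) = loopLaw d α E * loopLaw d α F := by
  have hi : iIndepFun (fun (ℓ : Loop d) (ω : Loop d → ℕ) => ω ℓ) (loopLaw d α) :=
    iIndepFun_infinitePi (X := fun _ k => k) fun _ => measurable_id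
  have := indep_iSup_of_disjoint (fun ℓ => (measurable_pi_apply ℓ).comap_le) hi h
  exact (Indep_iff _ _ _).1 this E F hE hF

theorem loopLaw_biInter_eq {d : ℕ} (α : ℝ≥0) {ι : Type*} (s : Finset ι) {S : ι → Set (Loop d)}
    (hS : Pairwise fun i j => Disjoint (S i) (S j)) {E : ι → Set (Loop d → ℕ)}
    (hE : ∀ i, MeasurableSet[loopSigma (S i)] (E i)) :
    loopLaw d α (⋂ i ∈ s, E i) = ∏ i ∈ s, loopLaw d α (E i) := by
  classical
  induction s using Finset.induction_on with
  | empty => simp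
  | insert i s hi ih =>
    rw [Finset.prod_insert hi, Finset.set_biInter_insert, ← ih]
    refine loopLaw_inter_eq α (T := ⋃ j ∈ s, S j) ?_ (hE i) ?_
    · rw [Set.disjoint_iUnion₂_right]
      exact fun j hj => hS fun e => hi (e ▸ hj)
    · exact @Finset.measurableSet_biInter _ _ (loopSigma _) _ s fun j hj =>
        loopSigma_mono (Set.subset_biUnion_of_mem (u := S) hj) _ (hE j)

/-! ### Arm events -/

theorem openGraph_mono {d : ℕ} {ω ω' : Loop d → ℕ} (h : ω ≤ ω') : openGraph d ω ≤ openGraph d ω' := by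
  rintro x y ⟨hxy, ℓ, hℓ, hs⟩
  exact ⟨hxy, ℓ, hℓ.trans (h ℓ), hs⟩

theorem openGraph_le_lattice {d : ℕ} (ω : Loop d → ℕ) : openGraph d ω ≤ lattice d :=
  fun _ _ h => h.1

/-- The event that an open path made of loops in `S` joins the ball of radius `n` around `x₀` to the
complement of the open ball of radius `m`. -/
def arm {d : ℕ} (S : Set (Loop d)) (x₀ : Site d) (n m : ℕ) : Set (Loop d → ℕ) :=
  {ω | ∃ u v, rad x₀ u ≤ n ∧ m ≤ rad x₀ v ∧ (openGraph d (S.indicator ω)).Reachable u v}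

theorem arm_subset_univ {d : ℕ} (S : Set (Loop d)) (x₀ : Site d) (n m : ℕ) :
    arm S x₀ n m ⊆ arm Set.univ x₀ n m := by
  rintro ω ⟨u, v, hu, hv, h⟩
  refine ⟨u, v, hu, hv, h.mono (openGraph_mono ?_)⟩
  rw [Set.indicator_univ]
  exact Set.indicator_le_self _ _

/-- Reachability is a countable union over finite vertex lists, and each adjacency is a countable
union over loops. -/
theorem measurableSet_reachable {d : ℕ} (u v : Site d) :
    MeasurableSet {ω : Loop d → ℕ | (openGraph d ω).Reachable u v} := by
  have hadj : ∀ x y, MeasurableSet {ω : Loop d → ℕ | (openGraph d ω).Adj x y} := fun x y => by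
    have : {ω : Loop d → ℕ | (openGraph d ω).Adj x y} = ⋃ ℓ : Loop d,
        {ω | (lattice d).Adj x y ∧ 1 ≤ ω ℓ ∧ (ℓ.Steps x y ∨ ℓ.Steps y x)} := by
      ext ω; simp [openGraph]
    rw [this]
    refine MeasurableSet.iUnion fun ℓ => ?_
    refine (MeasurableSet.const _).inter (MeasurableSet.inter ?_ (MeasurableSet.const _))
    exact measurable_pi_apply ℓ (MeasurableSet.of_discrete (s := {k : ℕ | 1 ≤ k}))
  have hchain : ∀ (l : List (Site d)) (x : Site d),
      MeasurableSet {ω : Loop d → ℕ | List.IsChain (openGraph d ω).Adj (x :: l)} := by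
    intro l
    induction l with
    | nil => simp
    | cons y l ih =>
      intro x
      simp only [List.isChain_cons_cons]
      exact (hadj x y).inter (ih y)
  have : {ω : Loop d → ℕ | (openGraph d ω).Reachable u v} = ⋃ l : List (Site d),
      {ω | List.IsChain (openGraph d ω).Adj (u :: l) ∧
        (u :: l).getLast (List.cons_ne_nil _ _) = v} := by
    ext ω
    simp only [Set.mem_ofPred_eq, Set.mem_iUnion, SimpleGraph.reachable_iff_reflTransGen]
    constructor
    · intro h
      exact List.exists_isChain_cons_of_relationReflTransGen h
    · rintro ⟨l, hl, rfl⟩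
      exact List.relationReflTransGen_of_exists_isChain_cons l hl rfl
  rw [this]
  exact MeasurableSet.iUnion fun l => (hchain l u).inter (MeasurableSet.const _)

theorem measurableSet_arm {d : ℕ} (S : Set (Loop d)) (x₀ : Site d) (n m : ℕ) :
    MeasurableSet[loopSigma S] (arm S x₀ n m) := by
  have : arm S x₀ n m = (fun ω : Loop d → ℕ => S.indicator ω) ⁻¹'
      ⋃ u : Site d, ⋃ v : Site d, {ω | rad x₀ u ≤ n ∧ m ≤ rad x₀ v ∧ (openGraph d ω).Reachable u v} := by
    ext ω; simp [arm]
  rw [this]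
  refine measurable_indicator_loopSigma S (MeasurableSet.iUnion fun u => MeasurableSet.iUnion fun v => ?_)
  exact (MeasurableSet.const _).inter ((MeasurableSet.const _).inter (measurableSet_reachable u v))

theorem Loop.Steps.left_mem {d : ℕ} {ℓ : Loop d} {x y : Site d} (h : ℓ.Steps x y) : x ∈ ℓ.1 := by
  obtain ⟨l, hl⟩ := h
  rw [← hl, Cycle.mem_coe_iff]; simp

theorem Loop.Steps.right_mem {d : ℕ} {ℓ : Loop d} {x y : Site d} (h : ℓ.Steps x y) : y ∈ ℓ.1 := by
  obtain ⟨l, hl⟩ := h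
  rw [← hl, Cycle.mem_coe_iff]; simp

/-- A nearest-neighbour path from radius at most `n` to radius at least `m` contains a crossing of the
shell between these radii. -/
theorem exists_crossing {d : ℕ} {G : SimpleGraph (Site d)} (hG : G ≤ lattice d) {x₀ u v : Site d}
    {n m : ℕ} (hnm : n ≤ m) (hu : rad x₀ u ≤ n) (hv : m ≤ rad x₀ v) (h : G.Reachable u v)
    {G' : SimpleGraph (Site d)}
    (hG' : ∀ x y, G.Adj x y → n ≤ rad x₀ x → rad x₀ x ≤ m → n ≤ rad x₀ y → rad x₀ y ≤ m → G'.Adj x y) :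
    ∃ u' v', rad x₀ u' = n ∧ rad x₀ v' = m ∧ G'.Reachable u' v' ∧ G.Reachable u u' ∧ G.Reachable u v' := by
  -- Stop at the first visit to radius `m` and look back to the last passage through radius `n`. The
  -- second alternative carries a partial crossing whose start is still outside the inner radius.
  have key : ∀ u v (_ : G.Walk u v), rad x₀ u ≤ m → m ≤ rad x₀ v →
      (∃ u' v', rad x₀ u' = n ∧ rad x₀ v' = m ∧ G'.Reachable u' v' ∧ G.Reachable u u' ∧
        G.Reachable u v') ∨
      (n ≤ rad x₀ u ∧ ∃ v', rad x₀ v' = m ∧ G'.Reachable u v' ∧ G.Reachable u v') := by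
    intro u v p
    induction p with
    | nil =>
      intro h1 h2
      exact Or.inr ⟨hnm.trans h2, _, le_antisymm h1 h2, SimpleGraph.Reachable.rfl,
        SimpleGraph.Reachable.rfl⟩
    | @cons a b c hab p ih =>
      intro h1 h2
      rcases h1.eq_or_lt with h1' | h1'
      · exact Or.inr ⟨by omega, a, h1', SimpleGraph.Reachable.rfl, SimpleGraph.Reachable.rfl⟩
      have hb := rad_le_add_one_of_adj (hG hab) x₀
      have hab' : G.Reachable a b := hab.reachable
      rcases ih (by omega) h2 with ⟨u', v', e1, e2, e3, e4, e5⟩ | ⟨hn, v', e2, e3, e5⟩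
      · exact Or.inl ⟨u', v', e1, e2, e3, hab'.trans e4, hab'.trans e5⟩
      · by_cases ha : n ≤ rad x₀ a
        · exact Or.inr ⟨ha, v', e2, (hG' a b hab ha h1 hn (by omega)).reachable.trans e3,
            hab'.trans e5⟩
        · exact Or.inl ⟨b, v', by omega, e2, e3, hab', hab'.trans e5⟩
  obtain ⟨p⟩ := h
  rcases key u v p (hu.trans hnm) hv with h | ⟨hn, v', e2, e3, e5⟩
  · exact h
  · exact ⟨u, v', le_antisymm hu hn, e2, e3, SimpleGraph.Reachable.rfl, e5⟩

/-- If all present loops visiting a shell belong to `S`, a crossing of the shell is made of loops in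
`S`. -/
theorem mem_arm_of_reachable {d : ℕ} {ω : Loop d → ℕ} {S : Set (Loop d)} {x₀ u v : Site d} {n m : ℕ}
    (hnm : n ≤ m) (hu : rad x₀ u ≤ n) (hv : m ≤ rad x₀ v) (h : (openGraph d ω).Reachable u v)
    (hS : ∀ ℓ, 1 ≤ ω ℓ → ℓ ∈ loopsHitting {x | n ≤ rad x₀ x ∧ rad x₀ x ≤ m} → ℓ ∈ S) :
    ω ∈ arm S x₀ n m := by
  have hloc : ∀ x y, (openGraph d ω).Adj x y → n ≤ rad x₀ x → rad x₀ x ≤ m → n ≤ rad x₀ y →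
      rad x₀ y ≤ m → (openGraph d (S.indicator ω)).Adj x y := by
    rintro x y ⟨hxy, ℓ, hℓ, hs⟩ h1 h2 - -
    have hx : x ∈ ℓ.1 := hs.elim Loop.Steps.left_mem Loop.Steps.right_mem
    exact ⟨hxy, ℓ, by rwa [Set.indicator_of_mem (hS ℓ hℓ ⟨x, hx, h1, h2⟩)], hs⟩
  obtain ⟨u', v', e1, e2, e3, -⟩ := exists_crossing (openGraph_le_lattice ω) hnm hu hv h hloc
  exact ⟨u', v', e1.le, e2.ge, e3⟩

/-! ### Renormalization at small intensity -/

/-- Base case of the renormalization: the first edge of the arm already forces a loop through a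
vertex of the ball of radius `L`. -/
theorem loopLaw_arm_le_of_lt {d : ℕ} {C : ℝ≥0}
    (hC : ∀ x : Site d, loopMeasure (loopsHitting {x}) ≤ C) (α : ℝ≥0) (x₀ : Site d) {n L : ℕ}
    (hn : 1 ≤ n) (hL : n ≤ L) :
    loopLaw d α (arm Set.univ x₀ n (2 * n)) ≤ (α * ((2 * L + 1) ^ d * C) : ℝ≥0) := by
  have hsub : arm Set.univ x₀ n (2 * n) ⊆
      presentIn (⋃ x ∈ ballFinset x₀ L, loopsHitting {x}) := by
    rintro ω ⟨u, v, hu, hv, ⟨p⟩⟩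
    cases p with
    | nil => omega
    | cons h p =>
      obtain ⟨-, ℓ, hℓ, hs⟩ := h
      have hx : u ∈ ℓ.1 := hs.elim Loop.Steps.left_mem Loop.Steps.right_mem
      rw [Set.indicator_univ] at hℓ
      refine ⟨ℓ, ?_, hℓ⟩
      simp only [Set.mem_iUnion]
      exact ⟨u, mem_ballFinset.2 (hu.trans hL), u, hx, rfl⟩
  refine (measure_mono hsub).trans ((loopLaw_presentIn_le α _).trans ?_)
  rw [ENNReal.coe_mul]
  gcongr
  refine (loopMeasure_biUnion_le _ _).trans ((Finset.sum_le_card_nsmul _ _ _ fun x _ => hC x).trans ?_)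
  rw [card_ballFinset, nsmul_eq_mul]
  push_cast
  rfl

theorem exists_grid_point {d : ℕ} (x₀ u : Site d) {k R : ℕ} (hk : 1 ≤ k) (hu : rad x₀ u ≤ R * k) :
    ∃ w ∈ ballFinset (0 : Site d) R, rad (x₀ + (k : ℤ) • w) u ≤ k := by
  have hk' : (0 : ℤ) < k := by exact_mod_cast hk
  refine ⟨fun i => (u i - x₀ i) / k, mem_ballFinset.2 (rad_le_iff.2 fun i => ?_),
    rad_le_iff.2 fun i => ?_⟩
  · have h := abs_le.1 ((abs_sub_le_rad x₀ u i).trans (by exact_mod_cast hu : (rad x₀ u : ℤ) ≤ (R : ℤ) * k))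
    rw [Pi.zero_apply, sub_zero, abs_le]
    constructor
    · rw [Int.le_ediv_iff_mul_le hk']; linarith
    · exact Int.ediv_le_of_le_mul hk' (by linarith)
  · have h1 := Int.emod_nonneg (u i - x₀ i) hk'.ne'
    have h2 := Int.emod_lt_of_pos (u i - x₀ i) hk'
    have h3 := Int.emod_add_mul_ediv (u i - x₀ i) k
    simp only [Pi.add_apply, Pi.smul_apply, smul_eq_mul]
    rw [abs_le]
    constructor <;> linarith

/-- One renormalization step: a crossing at scale `n` forces two crossings at a smaller scale `k` by
disjoint sets of loops, or a loop of diameter comparable to `n`. -/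
theorem loopLaw_arm_le_sq {d : ℕ} (hd : 1 ≤ d) {C α : ℝ≥0}
    (hC : ∀ (x₀ : Site d) (n m : ℕ), 1 ≤ n → 2 * d * n ≤ m →
      loopMeasure (loopsCrossing x₀ n m) ≤ C)
    {n k : ℕ} (hk : 1 ≤ k) (h1 : (4 * d + 4) * k ≤ n) (h2 : n ≤ 2 * (4 * d + 4) * k) {q : ℝ≥0∞}
    (hq : ∀ x₀ : Site d, loopLaw d α (arm Set.univ x₀ k (2 * k)) ≤ q) (x₀ : Site d) :
    loopLaw d α (arm Set.univ x₀ n (2 * n)) ≤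
      ((2 * (4 * (4 * d + 4)) + 1) ^ d) ^ 2 * (q ^ 2 + α * C) := by
  classical
  set R := 4 * (4 * d + 4) with hR
  set y : Site d → Site d := fun w => x₀ + (k : ℤ) • w with hy
  set S : Site d → Set (Loop d) := fun w => loopsHitting {x | rad (y w) x ≤ 2 * k} with hS
  set P : Finset (Site d × Site d) := (ballFinset 0 R ×ˢ ballFinset 0 R).filter
    fun p => (4 * d + 2) * k ≤ rad (y p.1) (y p.2) with hP
  have hsub : arm Set.univ x₀ n (2 * n) ⊆ ⋃ p ∈ P,
      (arm (S p.1 \ S p.2) (y p.1) k (2 * k) ∩ arm (S p.2 \ S p.1) (y p.2) k (2 * k)) ∪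
        presentIn (S p.1 ∩ S p.2) := by
    rintro ω ⟨u₀, v₀, hu₀, hv₀, h⟩
    rw [Set.indicator_univ] at h
    obtain ⟨u, v, hu, hv, huv, -⟩ := exists_crossing (G' := openGraph d ω)
      (openGraph_le_lattice ω) (by omega : n ≤ 2 * n) hu₀ hv₀ h fun _ _ h _ _ _ _ => h
    obtain ⟨w, hw, hwu⟩ := exists_grid_point x₀ u hk (R := R) (by rw [hu, hR]; nlinarith)
    obtain ⟨w', hw', hwv⟩ := exists_grid_point x₀ v hk (R := R) (by rw [hv, hR]; nlinarith)
    change rad (y w) u ≤ k at hwu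
    change rad (y w') v ≤ k at hwv
    have huv' : n ≤ rad u v := by have := rad_triangle x₀ u v; omega
    have hwv2 : n ≤ k + rad (y w) v := by
      have := rad_triangle u (y w) v
      rw [rad_comm u (y w)] at this
      omega
    have hwu2 : n ≤ k + rad (y w') u := by
      have := rad_triangle u (y w') v
      rw [rad_comm u (y w')] at this
      omega
    -- With this separation, a loop meeting both balls of radius 2k crosses from 2k to 2d · 2k
    -- around either centre, exactly what the measure bound requires.
    have hsep : (4 * d + 2) * k ≤ rad (y w) (y w') := by
      have := rad_triangle (y w) (y w') v
      have e : (4 * d + 4) * k = (4 * d + 2) * k + 2 * k := by ring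
      omega
    have hn3 : 3 * k ≤ n := le_trans (Nat.mul_le_mul_right k (by omega)) h1
    simp only [Set.mem_iUnion]
    refine ⟨(w, w'), by simp only [hP, Finset.mem_filter, Finset.mem_product]; exact ⟨⟨hw, hw'⟩, hsep⟩, ?_⟩
    -- If no present loop meets both balls, the two local crossings use disjoint families of loops
    -- and are independent.
    by_cases hpr : ω ∈ presentIn (S w ∩ S w')
    · exact Or.inr hpr
    refine Or.inl ⟨?_, ?_⟩
    · refine mem_arm_of_reachable (by omega) hwu (by omega : 2 * k ≤ rad (y w) v) huv ?_
      rintro ℓ hℓ ⟨x, hx, hx'⟩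
      have hin : ℓ ∈ S w := ⟨x, hx, hx'.2⟩
      exact ⟨hin, fun h => hpr ⟨ℓ, ⟨hin, h⟩, hℓ⟩⟩
    · refine mem_arm_of_reachable (by omega) hwv (by omega : 2 * k ≤ rad (y w') u) huv.symm ?_
      rintro ℓ hℓ ⟨x, hx, hx'⟩
      have hin : ℓ ∈ S w' := ⟨x, hx, hx'.2⟩
      exact ⟨hin, fun h => hpr ⟨ℓ, ⟨h, hin⟩, hℓ⟩⟩
  have hterm : ∀ p ∈ P, loopLaw d α
      ((arm (S p.1 \ S p.2) (y p.1) k (2 * k) ∩ arm (S p.2 \ S p.1) (y p.2) k (2 * k)) ∪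
        presentIn (S p.1 ∩ S p.2)) ≤ q ^ 2 + α * C := by
    rintro ⟨w, w'⟩ hp
    have hsep : (4 * d + 2) * k ≤ rad (y w) (y w') := (Finset.mem_filter.1 hp).2
    refine (measure_union_le _ _).trans (add_le_add ?_ ?_)
    · rw [loopLaw_inter_eq α (Set.disjoint_left.2 fun ℓ h h' => h.2 h'.1) (measurableSet_arm _ _ _ _)
        (measurableSet_arm _ _ _ _), sq]
      exact mul_le_mul' ((measure_mono (arm_subset_univ _ _ _ _)).trans (hq _))
        ((measure_mono (arm_subset_univ _ _ _ _)).trans (hq _))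
    · refine (loopLaw_presentIn_le α _).trans (mul_le_mul_right ?_ _)
      refine (loopMeasure_mono ?_).trans (hC (y w) (2 * k) (2 * d * (2 * k)) (by omega) le_rfl)
      rintro ℓ ⟨h, x, hx, hx'⟩
      refine ⟨h, x, hx, ?_⟩
      have h3 := rad_triangle (y w) x (y w')
      rw [rad_comm x (y w')] at h3
      have h4 : rad (y w') x ≤ 2 * k := hx'
      have e : (4 * d + 2) * k = 2 * d * (2 * k) + 2 * k := by ring
      change 2 * d * (2 * k) ≤ rad (y w) x
      omega
  refine (measure_mono hsub).trans ((measure_biUnion_finset_le _ _).trans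
    ((Finset.sum_le_card_nsmul _ _ _ hterm).trans ?_))
  rw [nsmul_eq_mul]
  gcongr
  have hcard : P.card ≤ ((2 * R + 1) ^ d) ^ 2 := by
    refine (Finset.card_filter_le _ _).trans (le_of_eq ?_)
    rw [Finset.card_product, card_ballFinset, sq]
  exact_mod_cast hcard

/-- At small intensity, annuli of ratio `2` are crossed with probability `O(α)` at all scales. -/
theorem exists_loopLaw_arm_le {d : ℕ} (hd : 3 ≤ d) : ∃ κ α₀ : ℝ≥0, 1 ≤ κ ∧ 0 < α₀ ∧
    ∀ α ≤ α₀, ∀ n : ℕ, 1 ≤ n → ∀ x₀ : Site d,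
      loopLaw d α (arm Set.univ x₀ n (2 * n)) ≤ (κ * α : ℝ≥0) := by
  obtain ⟨C, hC1, hC2, hC3⟩ := exists_loopMeasure_bound hd
  have hC3' : ∀ (x₀ : Site d) (n m : ℕ), 1 ≤ n → 2 * d * n ≤ m →
      loopMeasure (loopsCrossing x₀ n m) ≤ C := fun x₀ n m hn hm => by
    refine (hC3 x₀ n m hn hm).trans (ENNReal.coe_le_coe.2 (mul_le_of_le_one_right' ?_))
    refine pow_le_one₀ (by positivity) (div_le_one_of_le₀ ?_ (by positivity))
    exact_mod_cast le_trans (by nlinarith) hm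
  set L := 4 * d + 4 with hL
  set D : ℝ≥0 := ((2 * (4 * (L : ℝ≥0)) + 1) ^ d) ^ 2 with hD
  have hD1 : 1 ≤ D := one_le_pow₀ (one_le_pow₀ (by simp))
  -- The first summand makes DCα at most half of κα, and 2Dκα ≤ 1 does the same for the quadratic
  -- term; the second summand covers scales below `L`.
  set κ : ℝ≥0 := 2 * (D * C) + (2 * L + 1) ^ d * C with hκ
  have hDC : 1 ≤ D * C := one_le_mul hD1 hC1
  have hκ1 : 1 ≤ κ := le_trans hDC (by rw [hκ, two_mul, add_assoc]; exact le_self_add)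
  have hκ0 : 0 < κ := lt_of_lt_of_le one_pos hκ1
  have hD0 : 0 < D := lt_of_lt_of_le one_pos hD1
  refine ⟨κ, 1 / (2 * D * κ), hκ1, by positivity, fun α hα n => ?_⟩
  induction n using Nat.strong_induction_on with
  | _ n ih =>
    intro hn x₀
    rcases lt_or_ge n L with hnL | hnL
    · refine (loopLaw_arm_le_of_lt hC2 α x₀ hn hnL.le).trans (ENNReal.coe_le_coe.2 ?_)
      rw [mul_comm α]
      gcongr
      rw [hκ]
      exact le_add_self
    · have hk1 : 1 ≤ n / L := (Nat.one_le_div_iff (by omega)).2 hnL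
      have hkn : n / L < n := Nat.div_lt_self (by omega) (by omega)
      have h1 : L * (n / L) ≤ n := Nat.mul_div_le n L
      have h2 : n < L * (n / L + 1) := Nat.lt_mul_div_succ n (by omega)
      refine (loopLaw_arm_le_sq (by omega) hC3' hk1 h1 (by nlinarith) (ih _ hkn hk1) x₀).trans ?_
      have e : ((2 * (4 * (4 * (d : ℝ≥0∞) + 4)) + 1) ^ d) ^ 2 = (D : ℝ≥0∞) := by
        rw [hD, hL]; push_cast; rfl
      rw [e, ← ENNReal.coe_pow, ← ENNReal.coe_mul, ← ENNReal.coe_add, ← ENNReal.coe_mul,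
        ENNReal.coe_le_coe]
      have hα' : 2 * D * κ * α ≤ 1 := by
        rw [le_div_iff₀ (by positivity)] at hα
        rwa [mul_comm]
      have hκ2 : 2 * (D * C) ≤ κ := by rw [hκ]; exact le_self_add
      rw [← NNReal.coe_le_coe] at hα' hκ2 ⊢
      push_cast at hα' hκ2 ⊢
      have hp : (0 : ℝ) ≤ κ * α := by positivity
      have hα0 : (0 : ℝ) ≤ α := α.2
      nlinarith [mul_le_mul_of_nonneg_right hα' hp, mul_le_mul_of_nonneg_right hκ2 hα0]

/-! ### The multi-scale bound -/

/-- For each of the `k` starting scales the jump lengths give a geometric series of sum at most 2ρ.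
-/
theorem sum_pow_sub_le {ρ : ℝ} (h0 : 0 ≤ ρ) (h1 : ρ ≤ 1 / 2) (k : ℕ) :
    ∑ x ∈ (Finset.range k ×ˢ Finset.range k).filter (fun x => x.1 ≤ x.2), ρ ^ (x.2 - x.1 + 1) ≤
      k * (2 * ρ) := by
  rw [Finset.sum_filter, Finset.sum_product]
  refine (Finset.sum_le_card_nsmul _ _ (2 * ρ) fun i hi => ?_).trans (by simp)
  rw [← Finset.sum_filter]
  have hs : Summable fun n : ℕ => ρ ^ n := summable_geometric_of_lt_one h0 (by linarith)
  calc ∑ m ∈ (Finset.range k).filter (fun m => i ≤ m), ρ ^ (m - i + 1)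
      = ∑ l ∈ ((Finset.range k).filter (fun m => i ≤ m)).image (fun m => m - i), ρ ^ (l + 1) := by
        rw [Finset.sum_image]
        intro x hx y hy h
        simp only [Finset.coe_filter, Set.mem_ofPred_eq] at hx hy
        simp only at h
        omega
    _ = ρ * ∑ l ∈ ((Finset.range k).filter (fun m => i ≤ m)).image (fun m => m - i), ρ ^ l := by
        rw [Finset.mul_sum]; exact Finset.sum_congr rfl fun _ _ => by ring
    _ ≤ ρ * ∑' l : ℕ, ρ ^ l :=
        mul_le_mul_of_nonneg_left (hs.sum_le_tsum _ fun _ _ => by positivity) h0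
    _ = ρ * (1 - ρ)⁻¹ := by rw [tsum_geometric_of_lt_one h0 (by linarith)]
    _ ≤ ρ * 2 := by
        refine mul_le_mul_of_nonneg_left ?_ h0
        rw [inv_le_comm₀ (by linarith) (by norm_num)]
        linarith
    _ = 2 * ρ := by ring

/-- If each scale `j < k` is either crossed (event `E j`) or covered by a jump over the scales
`i, …, m` (event `F (i, m)`), and all these events are independent, then the probability decays
exponentially in `k`. -/
theorem measureReal_scales_le {Ω : Type*} [MeasurableSpace Ω] (μ : Measure Ω) [IsProbabilityMeasure μ]
    {E : ℕ → Set Ω} {F : ℕ × ℕ → Set Ω}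
    (hind : ∀ (s : Finset ℕ) (t : Finset (ℕ × ℕ)), μ.real ((⋂ j ∈ s, E j) ∩ ⋂ x ∈ t, F x) =
      (∏ j ∈ s, μ.real (E j)) * ∏ x ∈ t, μ.real (F x))
    {p q M : ℝ} (hp : 0 < p) (hp1 : p ≤ 1) (hq : 0 ≤ q) (hqp : q ≤ p / 2) (hM : 0 ≤ M) {k : ℕ}
    (hE : ∀ j < k, μ.real (E j) ≤ p)
    (hF : ∀ i m, i ≤ m → m < k → μ.real (F (i, m)) ≤ M * q ^ (m - i + 1)) {A : Set Ω}
    (hA : ∀ ω ∈ A, ∀ j < k, ω ∈ E j ∨ ∃ i m, i ≤ j ∧ j ≤ m ∧ m < k ∧ ω ∈ F (i, m)) :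
    μ.real A ≤ (p * Real.exp (2 * M * (q / p))) ^ k := by
  classical
  set P : Finset (ℕ × ℕ) := (Finset.range k ×ˢ Finset.range k).filter (fun x => x.1 ≤ x.2) with hP
  have hPmem : ∀ x, x ∈ P ↔ x.1 ≤ x.2 ∧ x.2 < k := fun x => by
    simp only [hP, Finset.mem_filter, Finset.mem_product, Finset.mem_range]; omega
  set U : Finset (ℕ × ℕ) → Finset ℕ := fun t =>
    (Finset.range k).filter fun j => ∀ x ∈ t, ¬(x.1 ≤ j ∧ j ≤ x.2) with hU
  -- Take `t` to be the set of all jumps that occur; every scale it leaves uncovered must be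
  -- crossed.
  have hsub : A ⊆ ⋃ t ∈ P.powerset, (⋂ j ∈ U t, E j) ∩ ⋂ x ∈ t, F x := by
    intro ω hω
    simp only [Set.mem_iUnion]
    refine ⟨P.filter fun x => ω ∈ F x, Finset.mem_powerset.2 (Finset.filter_subset _ _), ?_, ?_⟩
    · simp only [Set.mem_iInter]
      intro j hj
      simp only [hU, Finset.mem_filter, Finset.mem_range] at hj
      refine (hA ω hω j hj.1).resolve_right ?_
      rintro ⟨i, m, h1, h2, h3, h4⟩
      exact hj.2 (i, m) ⟨(hPmem _).2 ⟨h1.trans h2, h3⟩, h4⟩ ⟨h1, h2⟩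
    · simp only [Set.mem_iInter]
      exact fun x hx => (Finset.mem_filter.1 hx).2
  -- Uncovered scales and jump lengths together account for all `k` scales. So a factor p^k comes
  -- out, each jump keeps weight M(q/p)^length, and the sum over `t` becomes a product.
  have hcard : ∀ t ⊆ P, k ≤ (U t).card + ∑ x ∈ t, (x.2 - x.1 + 1) := by
    intro t ht
    have h1 : Finset.range k ⊆ U t ∪ t.biUnion fun x => Finset.Icc x.1 x.2 := by
      intro j hj
      by_cases h : ∀ x ∈ t, ¬(x.1 ≤ j ∧ j ≤ x.2)
      · exact Finset.mem_union_left _ (Finset.mem_filter.2 ⟨hj, h⟩)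
      · push Not at h
        obtain ⟨x, hx, h2⟩ := h
        exact Finset.mem_union_right _ (Finset.mem_biUnion.2 ⟨x, hx, Finset.mem_Icc.2 h2⟩)
    calc k = (Finset.range k).card := (Finset.card_range k).symm
      _ ≤ _ := Finset.card_le_card h1
      _ ≤ _ := Finset.card_union_le _ _
      _ ≤ _ := by
        gcongr
        refine Finset.card_biUnion_le.trans (Finset.sum_le_sum fun x hx => ?_)
        have := ((hPmem x).1 (ht hx)).1
        rw [Nat.card_Icc]; omega
  have hterm : ∀ t ∈ P.powerset, μ.real ((⋂ j ∈ U t, E j) ∩ ⋂ x ∈ t, F x) ≤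
      p ^ k * ∏ x ∈ t, (M * (q / p) ^ (x.2 - x.1 + 1)) := by
    intro t ht
    rw [Finset.mem_powerset] at ht
    have h1 : ∏ j ∈ U t, μ.real (E j) ≤ p ^ (U t).card := by
      refine (Finset.prod_le_prod (fun _ _ => measureReal_nonneg) fun j hj => hE j ?_).trans
        (by rw [Finset.prod_const])
      exact Finset.mem_range.1 (Finset.mem_filter.1 hj).1
    have h2 : ∏ x ∈ t, μ.real (F x) ≤ ∏ x ∈ t, (M * q ^ (x.2 - x.1 + 1)) :=
      Finset.prod_le_prod (fun _ _ => measureReal_nonneg) fun x hx =>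
        hF x.1 x.2 ((hPmem x).1 (ht hx)).1 ((hPmem x).1 (ht hx)).2
    have h3 : ∏ x ∈ t, (M * q ^ (x.2 - x.1 + 1)) =
        p ^ (∑ x ∈ t, (x.2 - x.1 + 1)) * ∏ x ∈ t, (M * (q / p) ^ (x.2 - x.1 + 1)) := by
      rw [← Finset.prod_pow_eq_pow_sum, ← Finset.prod_mul_distrib]
      refine Finset.prod_congr rfl fun x _ => ?_
      rw [div_pow]
      field_simp
    rw [hind]
    calc _ ≤ p ^ (U t).card * ∏ x ∈ t, (M * q ^ (x.2 - x.1 + 1)) :=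
          mul_le_mul h1 h2 (Finset.prod_nonneg fun _ _ => measureReal_nonneg) (by positivity)
      _ = p ^ ((U t).card + ∑ x ∈ t, (x.2 - x.1 + 1)) *
          ∏ x ∈ t, (M * (q / p) ^ (x.2 - x.1 + 1)) := by rw [h3, pow_add, mul_assoc]
      _ ≤ _ := mul_le_mul_of_nonneg_right (pow_le_pow_of_le_one hp.le hp1 (hcard t ht))
          (Finset.prod_nonneg fun _ _ => by positivity)
  calc μ.real A ≤ μ.real (⋃ t ∈ P.powerset, (⋂ j ∈ U t, E j) ∩ ⋂ x ∈ t, F x) :=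
        measureReal_mono hsub (measure_ne_top _ _)
    _ ≤ ∑ t ∈ P.powerset, μ.real ((⋂ j ∈ U t, E j) ∩ ⋂ x ∈ t, F x) :=
        measureReal_biUnion_finset_le _ _
    _ ≤ ∑ t ∈ P.powerset, p ^ k * ∏ x ∈ t, (M * (q / p) ^ (x.2 - x.1 + 1)) :=
        Finset.sum_le_sum hterm
    _ = p ^ k * ∏ x ∈ P, (1 + M * (q / p) ^ (x.2 - x.1 + 1)) := by
        rw [← Finset.mul_sum, Finset.prod_one_add]
    _ ≤ p ^ k * ∏ x ∈ P, Real.exp (M * (q / p) ^ (x.2 - x.1 + 1)) := by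
        refine mul_le_mul_of_nonneg_left (Finset.prod_le_prod (fun _ _ => by positivity)
          fun x _ => ?_) (by positivity)
        rw [add_comm]
        exact Real.add_one_le_exp _
    _ = p ^ k * Real.exp (M * ∑ x ∈ P, (q / p) ^ (x.2 - x.1 + 1)) := by
        rw [← Real.exp_sum, Finset.mul_sum]
    _ ≤ p ^ k * Real.exp (M * (k * (2 * (q / p)))) := by
        gcongr
        refine sum_pow_sub_le (by positivity) ?_ k
        rw [div_le_iff₀ hp]
        linarith
    _ = _ := by
        rw [mul_pow, ← Real.exp_nat_mul]
        congr 2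
        ring

/-- The loops contained in the annulus `n ≤ ‖x‖ < m`. -/
def loopsWithin (d n m : ℕ) : Set (Loop d) := {ℓ | ∀ x ∈ ℓ.1, n ≤ rad 0 x ∧ rad 0 x < m}

theorem Loop.exists_mem {d : ℕ} (ℓ : Loop d) : ∃ x, x ∈ ℓ.1 := by
  obtain ⟨c, hc, -⟩ := ℓ
  induction c using Quotient.inductionOn with
  | _ l =>
    cases l with
    | nil => exact absurd hc (by change ¬(2 ≤ 0); omega)
    | cons x l => exact ⟨x, Cycle.mem_coe_iff.2 List.mem_cons_self⟩

/-- Multi-scale bound on the one-arm probability, for scales `n₀ (a b a') ^ j`. -/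
theorem loopLaw_arm_le_pow {d : ℕ} (hd : 3 ≤ d) {C : ℝ≥0}
    (hC : ∀ (x₀ : Site d) (n m : ℕ), 1 ≤ n → 2 * d * n ≤ m →
      loopMeasure (loopsCrossing x₀ n m) ≤ (C * ((n : ℝ≥0) / m) ^ (d - 2) : ℝ≥0))
    (α : ℝ≥0) {a b a' n₀ : ℕ} (ha : 2 * d ≤ a) (hb : 1 ≤ b) (ha' : 2 * d ≤ a') (hn₀ : 1 ≤ n₀)
    {p q M : ℝ} (hp : 0 < p) (hp1 : p ≤ 1) (hq : 0 ≤ q) (hqp : q ≤ p / 2) (hM : 0 ≤ M)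
    (hE : ∀ n, n₀ ≤ n → (loopLaw d α).real (arm Set.univ 0 n (b * n)) ≤ p)
    (hq1 : (α : ℝ) * C * ((1 / (a : ℝ)) ^ (d - 2) + (1 / (a' : ℝ)) ^ (d - 2)) ≤ M * q)
    (hq2 : ∀ l : ℕ, 1 ≤ l → (α : ℝ) * C * ((b : ℝ) / ((a * b * a' : ℕ) : ℝ) ^ l) ^ (d - 2) ≤
      M * q ^ (l + 1)) {k N : ℕ} (hN : n₀ * (a * b * a') ^ k ≤ N) :
    (loopLaw d α).real (arm Set.univ 0 0 N) ≤ (p * Real.exp (2 * M * (q / p))) ^ k := by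
  classical
  set L := a * b * a' with hL
  set s : ℕ → ℕ := fun j => n₀ * L ^ j with hs
  have hs1 : ∀ j, s (j + 1) = a' * (b * (a * s j)) := fun j => by simp only [hs, hL]; ring
  have hL1 : 1 ≤ L := Nat.mul_pos (Nat.mul_pos (by omega) (by omega)) (by omega)
  have hspos : ∀ j, 1 ≤ s j := fun j => Nat.mul_pos hn₀ (pow_pos hL1 j)
  have hsmono : Monotone s := monotone_nat_of_le_succ fun j => by
    simp only [hs]; rw [pow_succ, ← mul_assoc]; exact Nat.le_mul_of_pos_right _ hL1
  have has : ∀ j, s j ≤ a * s j := fun j => Nat.le_mul_of_pos_left _ (by omega)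
  have hbas : ∀ j, a * s j ≤ b * (a * s j) := fun j => Nat.le_mul_of_pos_left _ (by omega)
  have hlts : ∀ j, b * (a * s j) < s (j + 1) := fun j => by
    rw [hs1]
    exact lt_mul_of_one_lt_left (Nat.mul_pos hb (Nat.mul_pos (by omega) (hspos j))) (by omega)
  have hunique : ∀ {i j r : ℕ}, s i ≤ r → r < s (i + 1) → s j ≤ r → r < s (j + 1) → i = j := by
    intro i j r h1 h2 h3 h4
    by_contra hne
    rcases Nat.lt_or_gt_of_ne hne with h | h
    · have := hsmono (show i + 1 ≤ j by omega); omega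
    · have := hsmono (show j + 1 ≤ i by omega); omega
  -- `S j` holds the loops confined to shell `j`; `J ℓ j` says that `ℓ` touches the middle annulus
  -- of shell `j` without being confined; `T` sorts loops by the extreme scales where `J` holds.
  set S : ℕ → Set (Loop d) := fun j => loopsWithin d (s j) (s (j + 1)) with hS
  set J : Loop d → ℕ → Prop := fun ℓ j =>
    ℓ ∈ loopsHitting {x | a * s j ≤ rad 0 x ∧ rad 0 x ≤ b * (a * s j)} ∧ ℓ ∉ S j with hJ
  set T : ℕ × ℕ → Set (Loop d) := fun x =>
    {ℓ | x.1 < k ∧ x.2 < k ∧ J ℓ x.1 ∧ J ℓ x.2 ∧ ∀ j < k, J ℓ j → x.1 ≤ j ∧ j ≤ x.2} with hT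
  set E : ℕ → Set (Loop d → ℕ) := fun j => arm (S j) 0 (a * s j) (b * (a * s j)) with hEdef
  set R : ℕ ⊕ ℕ × ℕ → Set (Loop d) := Sum.elim S T with hR
  -- A loop confined to shell `j` can touch no other middle annulus, and `J` fails for it at `j`
  -- itself.
  have hST : ∀ j x, Disjoint (S j) (T x) := fun j x => Set.disjoint_left.2 fun ℓ hℓ hx => by
    obtain ⟨⟨y, hy, hy1, hy2⟩, hnot⟩ := hx.2.2.1
    have h1 := hℓ y hy
    have := has x.1
    have := hlts x.1
    have e : x.1 = j := hunique (by omega) (by omega) h1.1 h1.2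
    exact hnot (e ▸ hℓ)
  have hdisj : Pairwise fun i j => Disjoint (R i) (R j) := by
    rintro (i | x) (j | y) hne
    · refine Set.disjoint_left.2 fun ℓ h1 h2 => hne ?_
      obtain ⟨z, hz⟩ := ℓ.exists_mem
      rw [hunique (h1 z hz).1 (h1 z hz).2 (h2 z hz).1 (h2 z hz).2]
    · exact hST i y
    · exact (hST j x).symm
    · refine Set.disjoint_left.2 fun ℓ h1 h2 => hne ?_
      obtain ⟨u1, u2, u3, u4, u5⟩ := h1
      obtain ⟨w1, w2, w3, w4, w5⟩ := h2
      have e1 : x.1 = y.1 := le_antisymm (u5 _ w1 w3).1 (w5 _ u1 u3).1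
      have e2 : x.2 = y.2 := le_antisymm (w5 _ u2 u4).2 (u5 _ w2 w4).2
      rw [Prod.ext e1 e2]
  have hind : ∀ (u : Finset ℕ) (t : Finset (ℕ × ℕ)),
      (loopLaw d α).real ((⋂ j ∈ u, E j) ∩ ⋂ x ∈ t, presentIn (T x)) =
      (∏ j ∈ u, (loopLaw d α).real (E j)) * ∏ x ∈ t, (loopLaw d α).real (presentIn (T x)) := by
    intro u t
    have h := loopLaw_biInter_eq α (u.disjSum t) hdisj (E := Sum.elim E fun x => presentIn (T x)) (by
      rintro (j | x)
      · exact measurableSet_arm _ _ _ _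
      · exact measurableSet_presentIn _)
    rw [Finset.prod_disjSum] at h
    have e : (⋂ i ∈ u.disjSum t, Sum.elim E (fun x => presentIn (T x)) i) =
        (⋂ j ∈ u, E j) ∩ ⋂ x ∈ t, presentIn (T x) := by
      ext ω
      simp only [Set.mem_iInter, Set.mem_inter_iff]
      constructor
      · exact fun h => ⟨fun j hj => h (Sum.inl j) (Finset.inl_mem_disjSum.2 hj),
          fun x hx => h (Sum.inr x) (Finset.inr_mem_disjSum.2 hx)⟩
      · rintro ⟨h1, h2⟩ (j | x) hi
        · exact h1 j (Finset.inl_mem_disjSum.1 hi)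
        · exact h2 x (Finset.inr_mem_disjSum.1 hi)
    rw [e] at h
    simp only [measureReal_def, h, ENNReal.toReal_mul, ENNReal.toReal_prod, Sum.elim_inl, Sum.elim_inr]
  have hpres : ∀ (V : Set (Loop d)) (r : ℝ≥0), loopMeasure V ≤ r →
      (loopLaw d α).real (presentIn V) ≤ α * r := fun V r hr => by
    refine ENNReal.toReal_le_of_le_ofReal (by positivity) ((loopLaw_presentIn_le α V).trans ?_)
    rw [ENNReal.ofReal_mul (by positivity), ENNReal.ofReal_coe_nnreal, ENNReal.ofReal_coe_nnreal]
    gcongr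
  refine measureReal_scales_le (loopLaw d α) hind hp hp1 hq hqp hM (fun j _ => ?_) ?_ ?_
  · refine (measureReal_mono (arm_subset_univ _ _ _ _) (measure_ne_top _ _)).trans (hE _ ?_)
    have := hsmono (Nat.zero_le j)
    have e : s 0 = n₀ := by simp [hs]
    have := has j
    omega
  · intro i m him hmk
    rcases him.eq_or_lt with rfl | him
    -- Leaving the shell from its middle annulus means crossing the inner buffer, of ratio `a`, or
    -- the outer one, of ratio `a'`.
    · have hsub : T (i, i) ⊆ loopsCrossing 0 (s i) (a * s i) ∪
          loopsCrossing 0 (b * (a * s i)) (s (i + 1)) := by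
        rintro ℓ ⟨-, -, ⟨⟨x, hx, hx1, hx2⟩, hnot⟩, -, -⟩
        simp only [hS, loopsWithin, Set.mem_ofPred_eq, not_forall] at hnot
        obtain ⟨y, hy, hy'⟩ := hnot
        rcases lt_or_ge (rad 0 y) (s i) with h | h
        · exact Or.inl ⟨⟨y, hy, h.le⟩, x, hx, hx1⟩
        · refine Or.inr ⟨⟨x, hx, hx2⟩, y, hy, ?_⟩
          change s (i + 1) ≤ rad 0 y
          by_contra hlt
          exact hy' ⟨h, by omega⟩
      have h1 := hC (0 : Site d) (s i) (a * s i) (hspos i) (Nat.mul_le_mul_right _ ha)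
      have h2 := hC (0 : Site d) (b * (a * s i)) (s (i + 1))
        (Nat.mul_pos hb (Nat.mul_pos (by omega) (hspos i))) (by
          rw [hs1]; exact Nat.mul_le_mul_right _ ha')
      have hm := ((loopMeasure_mono hsub).trans (loopMeasure_union_le _ _)).trans (add_le_add h1 h2)
      rw [← ENNReal.coe_add] at hm
      refine (hpres _ _ hm).trans ?_
      rw [Nat.sub_self, zero_add, pow_one]
      refine le_trans (le_of_eq ?_) hq1
      have e1 : ((s i : ℝ≥0) : ℝ) / ((a * s i : ℕ) : ℝ) = 1 / a := by
        have : (s i : ℝ) ≠ 0 := by exact_mod_cast Nat.one_le_iff_ne_zero.1 (hspos i)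
        push_cast; field_simp
      have e2 : ((b * (a * s i) : ℕ) : ℝ) / ((s (i + 1) : ℕ) : ℝ) = 1 / a' := by
        have : ((b * (a * s i) : ℕ) : ℝ) ≠ 0 := by
          exact_mod_cast (Nat.mul_pos hb (Nat.mul_pos (by omega) (hspos i))).ne'
        rw [hs1, Nat.cast_mul a']
        field_simp
      push_cast at e1 e2 ⊢
      rw [e1, e2]
      ring
    · obtain ⟨l, rfl⟩ : ∃ l, m = i + l := ⟨m - i, by omega⟩
      have hl : 1 ≤ l := by omega
      have hsub : T (i, i + l) ⊆ loopsCrossing 0 (b * (a * s i)) (a * s (i + l)) := by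
        rintro ℓ ⟨-, -, ⟨⟨x, hx, -, hx2⟩, -⟩, ⟨⟨y, hy, hy1, -⟩, -⟩, -⟩
        exact ⟨⟨x, hx, hx2⟩, y, hy, hy1⟩
      have hsl : s (i + l) = s i * L ^ l := by simp only [hs]; rw [pow_add, mul_assoc]
      have hcond : 2 * d * (b * (a * s i)) ≤ a * s (i + l) := by
        have h1 : L ≤ L ^ l := Nat.le_self_pow (by omega) L
        have h2 : 2 * d * b ≤ L := by
          rw [hL]
          exact (Nat.mul_le_mul_right b ha).trans (Nat.le_mul_of_pos_right _ (by omega))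
        calc 2 * d * (b * (a * s i)) = (2 * d * b) * (a * s i) := by ring
          _ ≤ L ^ l * (a * s i) := Nat.mul_le_mul_right _ (h2.trans h1)
          _ = a * s (i + l) := by rw [hsl]; ring
      have h1 := hC (0 : Site d) _ _ (Nat.mul_pos hb (Nat.mul_pos (by omega) (hspos i))) hcond
      refine (hpres _ _ ((loopMeasure_mono hsub).trans h1)).trans ?_
      rw [Nat.add_sub_cancel_left]
      refine le_trans (le_of_eq ?_) (hq2 l hl)
      have e1 : ((b * (a * s i) : ℕ) : ℝ) / ((a * s (i + l) : ℕ) : ℝ) = b / (L : ℝ) ^ l := by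
        have h2 : (s i : ℝ) ≠ 0 := by exact_mod_cast Nat.one_le_iff_ne_zero.1 (hspos i)
        have h3 : (a : ℝ) ≠ 0 := by exact_mod_cast (by omega : a ≠ 0)
        have h4 : (L : ℝ) ≠ 0 := by exact_mod_cast (by omega : L ≠ 0)
        rw [hsl]
        push_cast
        field_simp
      have e2 : (((b * (a * s i) : ℕ) : ℝ≥0) : ℝ) / (((a * s (i + l) : ℕ) : ℝ≥0) : ℝ) =
          b / (L : ℝ) ^ l := by simpa using e1
      rw [NNReal.coe_mul, NNReal.coe_pow, NNReal.coe_div, e2]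
      ring
  · rintro ω ⟨u, v, hu, hv, h⟩ j hj
    rw [Set.indicator_univ] at h
    by_contra hcon
    push Not at hcon
    obtain ⟨hcon1, hcon2⟩ := hcon
    refine hcon1 (mem_arm_of_reachable (hbas j) (hu.trans (Nat.zero_le _)) ?_ h fun ℓ hℓ hhit => ?_)
    · have h1 : s (j + 1) ≤ s k := hsmono hj
      have h2 := hlts j
      have h3 : s k ≤ N := hN
      omega
    · by_contra hnot
      -- The offending loop belongs to the class given by the minimum and maximum of `K`, an
      -- interval containing `j`.
      set K : Finset ℕ := (Finset.range k).filter (J ℓ) with hK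
      have hjK : j ∈ K := Finset.mem_filter.2 ⟨Finset.mem_range.2 hj, hhit, hnot⟩
      have hne : K.Nonempty := ⟨j, hjK⟩
      have hmin := Finset.mem_filter.1 (K.min'_mem hne)
      have hmax := Finset.mem_filter.1 (K.max'_mem hne)
      refine hcon2 (K.min' hne) (K.max' hne) (K.min'_le _ hjK) (K.le_max' _ hjK)
        (Finset.mem_range.1 hmax.1) ⟨ℓ, ⟨Finset.mem_range.1 hmin.1, Finset.mem_range.1 hmax.1,
          hmin.2, hmax.2, fun i hi hJi => ?_⟩, hℓ⟩
      have hiK : i ∈ K := Finset.mem_filter.2 ⟨Finset.mem_range.2 hi, hJi⟩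
      exact ⟨K.min'_le _ hiK, K.le_max' _ hiK⟩

/-! ### Connection probabilities and the threshold -/

theorem mem_box_iff {d n : ℕ} {x : Site d} : x ∈ box d n ↔ rad 0 x ≤ n := by
  simp [box, rad_le_iff]

theorem le_rad_of_mem_boundary {d n : ℕ} {x : Site d} (h : x ∈ boundary (box d n)) : n ≤ rad 0 x := by
  obtain ⟨-, y, hy, hxy⟩ := h
  rw [mem_box_iff] at hy
  have := rad_le_add_one_of_adj hxy 0
  omega

theorem mem_boundary_box {d n : ℕ} (hd : 0 < d) {x : Site d} (h : rad 0 x = n) :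
    x ∈ boundary (box d n) := by
  refine ⟨mem_box_iff.2 h.le, ?_⟩
  obtain ⟨i, hi⟩ := exists_abs_sub_eq_rad hd 0 x
  rw [Pi.zero_apply, sub_zero, h] at hi
  refine ⟨x + unitStep (i, decide (0 ≤ x i)), fun hmem => ?_, adj_iff_exists_unitStep.2 ⟨_, rfl⟩⟩
  have hi' := hmem i
  by_cases h0 : 0 ≤ x i
  · rw [abs_of_nonneg h0] at hi
    have := le_abs_self ((x + unitStep (i, decide (0 ≤ x i))) i)
    simp [unitStep, h0] at this hi'
    omega
  · rw [abs_of_neg (by omega)] at hi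
    have := neg_abs_le ((x + unitStep (i, decide (0 ≤ x i))) i)
    simp [unitStep, h0] at this hi'
    omega

theorem connectProb_le_one {d : ℕ} (α : ℝ≥0) (A B : Set (Site d)) : connectProb d α A B ≤ 1 :=
  measureReal_le_one

theorem connectProb_nonneg {d : ℕ} (α : ℝ≥0) (A B : Set (Site d)) : 0 ≤ connectProb d α A B :=
  measureReal_nonneg

theorem connectProb_box_le_arm {d : ℕ} (α : ℝ≥0) (n m : ℕ) :
    connectProb d α (box d n) (boundary (box d m)) ≤ (loopLaw d α).real (arm Set.univ 0 n m) := by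
  refine measureReal_mono ?_ (measure_ne_top _ _)
  rintro ω ⟨x, hx, y, hy, h⟩
  exact ⟨x, y, mem_box_iff.1 hx, le_rad_of_mem_boundary hy, by rwa [Set.indicator_univ]⟩

theorem connectProb_zero_le_arm {d : ℕ} (α : ℝ≥0) (N : ℕ) :
    connectProb d α {0} (boundary (box d N)) ≤ (loopLaw d α).real (arm Set.univ 0 0 N) := by
  refine measureReal_mono ?_ (measure_ne_top _ _)
  rintro ω ⟨x, rfl, y, hy, h⟩
  exact ⟨0, y, (rad_self _).le, le_rad_of_mem_boundary hy, by rwa [Set.indicator_univ]⟩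

/-- The radius changes by at most one per step, so an arm reaching `m'` passes through radius
exactly `m`. -/
theorem arm_le_connectProb_box {d : ℕ} (hd : 0 < d) (α : ℝ≥0) {n m m' : ℕ} (hnm : n ≤ m) (hm : m ≤ m') :
    (loopLaw d α).real (arm Set.univ 0 n m') ≤ connectProb d α (box d n) (boundary (box d m)) := by
  refine measureReal_mono ?_ (measure_ne_top _ _)
  rintro ω ⟨u, v, hu, hv, h⟩
  rw [Set.indicator_univ] at h
  obtain ⟨u', v', hu', hv', -, -, huv⟩ := exists_crossing (G' := openGraph d ω)
    (openGraph_le_lattice ω) hnm hu (hm.trans hv) h fun _ _ h _ _ _ _ => h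
  exact ⟨u, mem_box_iff.2 hu, v', mem_boundary_box hd hv', huv⟩

theorem real_le_of_le_coe {d : ℕ} {α r : ℝ≥0} {A : Set (Loop d → ℕ)} (h : loopLaw d α A ≤ r) :
    (loopLaw d α).real A ≤ r :=
  ENNReal.toReal_le_of_le_ofReal r.2 (by rwa [ENNReal.ofReal_coe_nnreal])

/-- Ratio β = 2 suffices: for small α the crossing probabilities are at most κα ≤ 1/2, so the limsup
cannot be 1. -/
theorem crossingThreshold_pos {d : ℕ} (hd : 3 ≤ d) : 0 < crossingThreshold d := by
  obtain ⟨κ, α₀, hκ, hα₀, h⟩ := exists_loopLaw_arm_le hd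
  have hκ0 : 0 < κ := lt_of_lt_of_le one_pos hκ
  have hm : 0 < min α₀ (1 / (2 * κ)) := lt_min hα₀ (by positivity)
  refine lt_of_lt_of_le (ENNReal.coe_pos.2 hm) (le_iSup_of_le ⟨2, one_lt_two⟩ (le_iInf₂ ?_))
  rintro α ⟨-, hlim⟩
  rw [ENNReal.coe_le_coe]
  by_contra hlt
  rw [not_le] at hlt
  have hα1 : α ≤ α₀ := hlt.le.trans (min_le_left _ _)
  have hα2 : κ * α ≤ 1 / 2 := by
    have := hlt.le.trans (min_le_right _ _)
    rw [le_div_iff₀ (by positivity)] at this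
    rw [le_div_iff₀ (by positivity)]
    calc κ * α * 2 = α * (2 * κ) := by ring
      _ ≤ 1 := this
  have hle : limsup (fun n : ℕ => connectProb d α (box d n) (boundary (box d ⌈(2 : ℝ) * n⌉₊))) atTop ≤
      1 / 2 := by
    refine limsup_le_of_le ?_ ?_
    · exact isCoboundedUnder_le_of_le atTop fun n => connectProb_nonneg α _ _
    · filter_upwards [eventually_ge_atTop 1] with n hn
      have e : ⌈(2 : ℝ) * n⌉₊ = 2 * n := by
        have : (2 : ℝ) * n = ((2 * n : ℕ) : ℝ) := by push_cast; rfl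
        rw [this, Nat.ceil_natCast]
      rw [e]
      refine (connectProb_box_le_arm α n (2 * n)).trans ((real_le_of_le_coe (h α hα1 n hn 0)).trans ?_)
      exact_mod_cast hα2
  have hlim' : limsup (fun n : ℕ => connectProb d α (box d n) (boundary (box d ⌈(2 : ℝ) * n⌉₊))) atTop
      = 1 := hlim
  rw [hlim'] at hle
  norm_num at hle

/-- Below the threshold, annuli of some fixed ratio are crossed with probability bounded away from
one. -/
theorem exists_arm_le_of_lt_crossingThreshold {d : ℕ} (hd : 3 ≤ d) {α : ℝ≥0} (hα : 0 < α)
    (h : (α : ℝ≥0∞) < crossingThreshold d) :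
    ∃ (b n₀ : ℕ) (p : ℝ), 1 ≤ b ∧ 1 ≤ n₀ ∧ 0 < p ∧ p < 1 ∧
      ∀ n, n₀ ≤ n → (loopLaw d α).real (arm Set.univ 0 n (b * n)) ≤ p := by
  obtain ⟨⟨β, hβ⟩, hlt⟩ := lt_iSup_iff.1 h
  set f : ℕ → ℝ := fun n => connectProb d α (box d n) (boundary (box d ⌈β * n⌉₊)) with hf
  -- Lying strictly below the infimum excludes α itself from the set, so no monotonicity in α is
  -- needed.
  have hne : limsup f atTop ≠ 1 := fun heq => absurd hlt (not_lt.2 (iInf₂_le α ⟨hα, heq⟩))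
  have hbdd : IsBoundedUnder (· ≤ ·) atTop f := isBoundedUnder_of ⟨1, fun n => connectProb_le_one α _ _⟩
  have hle : limsup f atTop ≤ 1 := limsup_le_of_le
    (isCoboundedUnder_le_of_le atTop fun n => connectProb_nonneg α _ _)
    (Eventually.of_forall fun n => connectProb_le_one α _ _)
  obtain ⟨r, hr1, hr2⟩ := exists_between (lt_of_le_of_ne hle hne)
  obtain ⟨n₁, hn₁⟩ := eventually_atTop.1 (eventually_lt_of_limsup_lt hr1 hbdd)
  refine ⟨⌈β⌉₊, max n₁ 1, max r (1 / 2), Nat.one_le_ceil_iff.2 (by linarith), le_max_right _ _,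
    lt_max_of_lt_right (by norm_num), max_lt hr2 (by norm_num), fun n hn => ?_⟩
  have h1 : n ≤ ⌈β * n⌉₊ := by
    have h2 : (n : ℝ) ≤ β * n := le_mul_of_one_le_left (by positivity) hβ.le
    exact_mod_cast h2.trans (Nat.le_ceil _)
  have h2 : ⌈β * n⌉₊ ≤ ⌈β⌉₊ * n := by
    refine Nat.ceil_le.2 ?_
    push_cast
    exact mul_le_mul_of_nonneg_right (Nat.le_ceil _) (by positivity)
  exact (arm_le_connectProb_box (by omega) α h1 h2).trans
    ((hn₁ n (le_trans (le_max_left _ _) hn)).le.trans (le_max_left _ _))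

/-- Exponential decay in the number of scales is polynomial decay in the distance. -/
theorem exists_rpow_bound_of_scales {f : ℕ → ℝ} (hf : ∀ N, f N ≤ 1) {η : ℝ} (hη : 0 < η) (hη1 : η ≤ 1)
    {L n₀ : ℕ} (hL : 2 ≤ L) (hn₀ : 1 ≤ n₀) (h : ∀ k N, n₀ * L ^ k ≤ N → f N ≤ η ^ k) :
    ∃ C : ℝ, 0 < C ∧ ∀ N : ℕ, 1 ≤ N → f N ≤ C * (N : ℝ) ^ (Real.log η / Real.log L) := by
  have hL' : (2 : ℝ) ≤ L := by exact_mod_cast hL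
  have hL0 : (0 : ℝ) < L := by linarith
  have hlogL : 0 < Real.log L := Real.log_pos (by linarith)
  set e := Real.log η / Real.log L with he
  have he0 : e ≤ 0 := div_nonpos_of_nonpos_of_nonneg (Real.log_nonpos hη.le hη1) hlogL.le
  have hLe : (L : ℝ) ^ e = η := by
    rw [Real.rpow_def_of_pos hL0, he, mul_div_cancel₀ _ hlogL.ne', Real.exp_log hη]
  have hn0 : (0 : ℝ) < n₀ := by exact_mod_cast hn₀
  have hne : (0 : ℝ) < (n₀ : ℝ) ^ e := by positivity
  -- The factor 1/η pays for rounding `N` down to a full scale, and `n₀` for the initial one.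
  refine ⟨1 / ((n₀ : ℝ) ^ e * η), by positivity, fun N hN => ?_⟩
  have hN0 : (0 : ℝ) < N := by exact_mod_cast hN
  rw [one_div_mul_eq_div, le_div_iff₀ (by positivity)]
  rcases lt_or_ge N n₀ with hlt | hge
  · have h1 : (n₀ : ℝ) ^ e ≤ (N : ℝ) ^ e :=
      Real.rpow_le_rpow_of_nonpos hN0 (by exact_mod_cast hlt.le) he0
    have h2 : (n₀ : ℝ) ^ e * η ≤ (N : ℝ) ^ e * 1 := mul_le_mul h1 hη1 hη.le (by positivity)
    calc f N * ((n₀ : ℝ) ^ e * η) ≤ 1 * ((n₀ : ℝ) ^ e * η) :=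
          mul_le_mul_of_nonneg_right (hf N) (by positivity)
      _ ≤ _ := by linarith
  · have hdiv : N / n₀ ≠ 0 := (Nat.div_pos hge hn₀).ne'
    set k := Nat.log L (N / n₀) with hk
    have h1 : n₀ * L ^ k ≤ N :=
      (Nat.mul_le_mul_left _ (Nat.pow_log_le_self L hdiv)).trans (Nat.mul_div_le N n₀)
    have h2 : N < n₀ * L ^ (k + 1) := by
      have h3 := Nat.lt_pow_succ_log_self (by omega : 1 < L) (N / n₀)
      have h4 := Nat.lt_mul_div_succ N hn₀
      exact h4.trans_le (Nat.mul_le_mul_left _ h3)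
    have h3 : (n₀ : ℝ) ^ e * η ^ (k + 1) ≤ (N : ℝ) ^ e := by
      have h4 : (N : ℝ) ≤ n₀ * (L : ℝ) ^ (k + 1) := by exact_mod_cast h2.le
      refine le_trans (le_of_eq ?_) (Real.rpow_le_rpow_of_nonpos hN0 h4 he0)
      rw [Real.mul_rpow hn0.le (by positivity), ← hLe, ← Real.rpow_natCast, ← Real.rpow_natCast,
        ← Real.rpow_mul hL0.le, ← Real.rpow_mul hL0.le, mul_comm e]
    calc f N * ((n₀ : ℝ) ^ e * η) ≤ η ^ k * ((n₀ : ℝ) ^ e * η) :=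
          mul_le_mul_of_nonneg_right (h k N h1) (by positivity)
      _ = (n₀ : ℝ) ^ e * η ^ (k + 1) := by ring
      _ ≤ _ := h3

/-- Polynomial decay of the one-arm probability below the threshold. -/
theorem exists_arm_decay {d : ℕ} (hd : 3 ≤ d) {α : ℝ≥0} (hα : 0 < α)
    (h : (α : ℝ≥0∞) < crossingThreshold d) :
    ∃ C c : ℝ, 0 < c ∧ ∀ N : ℕ, 1 ≤ N →
      (loopLaw d α).real (arm Set.univ 0 0 N) ≤ C * (N : ℝ) ^ (-c) := by
  obtain ⟨C, hC1, -, hC⟩ := exists_loopMeasure_bound hd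
  obtain ⟨b, n₀, p, hb, hn₀, hp, hp1, hE⟩ := exists_arm_le_of_lt_crossingThreshold hd hα h
  set M : ℝ := 2 * (α * C) with hM
  have hM0 : 0 ≤ M := by positivity
  have hq : Tendsto (fun a : ℕ => (1 / (a : ℝ)) ^ (d - 2)) atTop (𝓝 0) := by
    have := (tendsto_one_div_atTop_nhds_zero_nat (𝕜 := ℝ)).pow (d - 2)
    rwa [zero_pow (by omega)] at this
  have hη : Tendsto (fun a : ℕ => p * Real.exp (2 * M * ((1 / (a : ℝ)) ^ (d - 2) / p))) atTop (𝓝 p) := by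
    have := (((hq.div_const p).const_mul (2 * M)).rexp).const_mul p
    simpa using this
  -- Both buffers get the same large ratio `a`, chosen so that jumps raise the cost per scale from
  -- `p` to a value still below 1.
  obtain ⟨a, ha1, ha2, ha3⟩ := ((eventually_ge_atTop (2 * d)).and
    ((hq.eventually (gt_mem_nhds (half_pos hp))).and (hη.eventually (gt_mem_nhds hp1)))).exists
  set q : ℝ := (1 / (a : ℝ)) ^ (d - 2) with hqdef
  have ha0 : (1 : ℝ) ≤ a := by exact_mod_cast (by omega : 1 ≤ a)
  have hb0 : (1 : ℝ) ≤ b := by exact_mod_cast hb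
  have hL : 2 ≤ a * b * a := by
    have : 2 ≤ a * b := le_trans (by omega : 2 ≤ a) (Nat.le_mul_of_pos_right _ hb)
    exact this.trans (Nat.le_mul_of_pos_right _ (by omega))
  have hpow : ∀ k N, n₀ * (a * b * a) ^ k ≤ N → (loopLaw d α).real (arm Set.univ 0 0 N) ≤
      (p * Real.exp (2 * M * (q / p))) ^ k := by
    intro k N hN
    refine loopLaw_arm_le_pow hd hC α ha1 hb ha1 hn₀ hp hp1.le (by positivity) ha2.le hM0 hE ?_ ?_ hN
    · rw [← hqdef, hM]; linarith
    · intro l hl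
      have hfrac : (b : ℝ) / ((a * b * a : ℕ) : ℝ) ^ l ≤ (1 / (a : ℝ)) ^ (l + 1) := by
        rw [div_le_iff₀ (by push_cast; positivity), one_div, inv_pow, ← div_eq_inv_mul,
          le_div_iff₀ (by positivity)]
        push_cast
        calc (b : ℝ) * (a : ℝ) ^ (l + 1) ≤ b ^ l * a ^ (2 * l) := by
              gcongr
              · exact le_self_pow₀ hb0 (by omega)
              · omega
          _ = (a * b * a : ℝ) ^ l := by rw [pow_mul]; ring
      calc (α : ℝ) * C * ((b : ℝ) / ((a * b * a : ℕ) : ℝ) ^ l) ^ (d - 2)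
          ≤ α * C * ((1 / (a : ℝ)) ^ (l + 1)) ^ (d - 2) := by gcongr
        _ = α * C * q ^ (l + 1) := by rw [hqdef, ← pow_mul, ← pow_mul, mul_comm (l + 1)]
        _ ≤ M * q ^ (l + 1) := by
          gcongr
          rw [hM]
          have : (0 : ℝ) ≤ α * C := by positivity
          linarith
  obtain ⟨K, -, hK⟩ := exists_rpow_bound_of_scales (fun N => measureReal_le_one) (by positivity) ha3.le
    hL hn₀ hpow
  refine ⟨K, -(Real.log (p * Real.exp (2 * M * (q / p))) / Real.log ((a * b * a : ℕ) : ℝ)), ?_, ?_⟩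
  · refine neg_pos.2 (div_neg_of_neg_of_pos (Real.log_neg (by positivity) ha3) (Real.log_pos ?_))
    exact_mod_cast hL
  · simpa only [neg_neg] using hK

/-- Multi-scale bound at small intensity, with the largest factor of the scale ratio of order
`α ^ (-1 / (d - 2))`. -/
theorem loopLaw_arm_le_pow_small {d : ℕ} (hd : 3 ≤ d) {C : ℝ≥0}
    (hC : ∀ (x₀ : Site d) (n m : ℕ), 1 ≤ n → 2 * d * n ≤ m →
      loopMeasure (loopsCrossing x₀ n m) ≤ (C * ((n : ℝ≥0) / m) ^ (d - 2) : ℝ≥0))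
    {α κ : ℝ≥0} (hα : 0 < α) (hκ : 1 ≤ κ) (hp1 : 2 * (κ : ℝ) * α ≤ 1)
    (harm : ∀ n : ℕ, 1 ≤ n → (loopLaw d α).real (arm Set.univ 0 n (2 * n)) ≤ κ * α)
    {a' : ℕ} (ha' : 2 * d ≤ a') (ha'pow : (1 / (a' : ℝ)) ^ (d - 2) ≤ α) {k N : ℕ}
    (hN : 1 * (2 * d * 2 * a') ^ k ≤ N) :
    (loopLaw d α).real (arm Set.univ 0 0 N) ≤ (2 * κ * α * Real.exp (4 * C)) ^ k := by
  have hα0 : (0 : ℝ) < α := by exact_mod_cast hα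
  have hκ' : (1 : ℝ) ≤ κ := by exact_mod_cast hκ
  have hd' : (3 : ℝ) ≤ d := by exact_mod_cast hd
  have hp : 0 < 2 * (κ : ℝ) * α := by positivity
  have hα1 : (α : ℝ) ≤ 1 := by nlinarith
  have ha0 : (0 : ℝ) < a' := by exact_mod_cast (by omega : 0 < a')
  have he : 2 * (4 * (C : ℝ)) * (κ * α / (2 * κ * α)) = 4 * C := by field_simp
  rw [← he]
  -- Only the outer buffer is large: the intensity gives one factor α, and each further scale
  -- spanned by a jump gives another through `a'`. Enlarging the inner buffer likewise would waste
  -- half the exponent. The doubled `p` makes q/p equal to 1/2.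
  refine loopLaw_arm_le_pow hd hC α (a := 2 * d) (b := 2) (a' := a') (n₀ := 1) (q := κ * α)
    (M := 4 * C) le_rfl one_le_two ha' le_rfl hp hp1 (by positivity)
    (by linarith) (by positivity) (fun n hn => ?_) ?_ (fun l hl => ?_) hN
  · have : 0 ≤ (κ : ℝ) * α := by positivity
    linarith [harm n hn]
  · have h4 : (1 / ((2 * d : ℕ) : ℝ)) ^ (d - 2) ≤ 1 := by
      refine pow_le_one₀ (by positivity) ?_
      rw [div_le_one (by positivity)]
      push_cast; linarith
    have h5 := ha'pow.trans hα1
    have h6 : 0 ≤ (α : ℝ) * C := by positivity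
    linarith [mul_le_mul_of_nonneg_left hκ' h6, mul_le_mul_of_nonneg_left (add_le_add h4 h5) h6]
  · have hfrac : ((2 : ℕ) : ℝ) / ((2 * d * 2 * a' : ℕ) : ℝ) ^ l ≤ (1 / (a' : ℝ)) ^ l := by
      have h7 : 2 * (a' : ℝ) ≤ ((2 * d * 2 * a' : ℕ) : ℝ) := by
        exact_mod_cast Nat.mul_le_mul_right a' (by omega : 2 ≤ 2 * d * 2)
      have h8 : (0 : ℝ) < ((2 * d * 2 * a' : ℕ) : ℝ) := by linarith
      rw [div_le_iff₀ (by positivity), one_div, inv_pow, ← div_eq_inv_mul,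
        le_div_iff₀ (by positivity)]
      calc ((2 : ℕ) : ℝ) * (a' : ℝ) ^ l ≤ 2 ^ l * (a' : ℝ) ^ l := by
            gcongr
            exact_mod_cast Nat.le_self_pow (by omega) 2
        _ = (2 * (a' : ℝ)) ^ l := (mul_pow _ _ _).symm
        _ ≤ ((2 * d * 2 * a' : ℕ) : ℝ) ^ l := pow_le_pow_left₀ (by positivity) h7 l
    calc (α : ℝ) * C * (((2 : ℕ) : ℝ) / ((2 * d * 2 * a' : ℕ) : ℝ) ^ l) ^ (d - 2)
        ≤ α * C * ((1 / (a' : ℝ)) ^ l) ^ (d - 2) :=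
          mul_le_mul_of_nonneg_left (pow_le_pow_left₀ (by positivity) hfrac _) (by positivity)
      _ = α * C * ((1 / (a' : ℝ)) ^ (d - 2)) ^ l := by rw [← pow_mul, ← pow_mul, mul_comm l]
      _ ≤ α * C * (α : ℝ) ^ l :=
          mul_le_mul_of_nonneg_left (pow_le_pow_left₀ (by positivity) ha'pow _) (by positivity)
      _ = C * (α : ℝ) ^ (l + 1) := by ring
      _ ≤ 4 * C * (κ * α) ^ (l + 1) := by
        have h9 : (C : ℝ) ≤ 4 * C := by linarith [C.2]
        exact mul_le_mul h9 (pow_le_pow_left₀ hα0.le (le_mul_of_one_le_left hα0.le hκ') _)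
          (by positivity) (by positivity)

/-- Here `X` is log(1/α), `g` is log Γ and `t` is the logarithm of the scale ratio. If the target
exponent is not positive the sign of g - X suffices; otherwise `t` is replaced by its upper bound
and `K` absorbs the constants. -/
theorem exponent_le {D X g e K t : ℝ} (hD : 0 < D) (hX : 0 < X) (he : 0 ≤ e) (ht : 0 < t)
    (hte : t ≤ e + X / D) (hg : g - X < 0) (hK0 : 0 ≤ K) (hK : D * (D * e + g) ≤ K) :
    (g - X) / t ≤ -(D - K / X) := by
  rw [div_le_iff₀ ht]
  rcases le_or_gt (D - K / X) 0 with hneg | hpos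
  · have : 0 ≤ -(D - K / X) * t := mul_nonneg (by linarith) ht.le
    linarith
  · have h1 : (D - K / X) * t ≤ (D - K / X) * (e + X / D) := mul_le_mul_of_nonneg_left hte hpos.le
    have h2 : (D - K / X) * (e + X / D) = X + D * e - K / D - K / X * e := by
      field_simp
      ring
    have h3 : D * e + g ≤ K / D := by
      rw [le_div_iff₀ hD]; linarith
    have h4 : 0 ≤ K / X * e := by positivity
    linarith

/-- At small intensity, the decay exponent is at least `d - 2 - K / log (1 / α)`. -/
theorem exists_arm_decay_small {d : ℕ} (hd : 3 ≤ d) : ∃ K₀ : ℝ, 0 < K₀ ∧ ∃ α₀ : ℝ≥0, 0 < α₀ ∧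
    ∀ α : ℝ≥0, 0 < α → α < α₀ → ∀ K : ℝ, K₀ ≤ K → ∃ C : ℝ, ∀ N : ℕ, 1 ≤ N →
      (loopLaw d α).real (arm Set.univ 0 0 N) ≤
        C * (N : ℝ) ^ (-((d : ℝ) - 2 - K / Real.log (1 / (α : ℝ)))) := by
  obtain ⟨C, hC1, -, hC⟩ := exists_loopMeasure_bound hd
  obtain ⟨κ, α₁, hκ, hα₁, hα₁'⟩ := exists_loopLaw_arm_le hd
  have hC1' : (1 : ℝ) ≤ C := by exact_mod_cast hC1
  have hκ' : (1 : ℝ) ≤ κ := by exact_mod_cast hκ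
  have hd' : (3 : ℝ) ≤ d := by exact_mod_cast hd
  set D : ℝ := (d : ℝ) - 2 with hD
  have hD1 : 1 ≤ D := by rw [hD]; linarith
  have hDnat : ((d - 2 : ℕ) : ℝ) = D := by rw [Nat.cast_sub (by omega), hD]; norm_num
  set Γ : ℝ≥0 := 2 * κ * Real.toNNReal (Real.exp (4 * C)) with hΓ
  have hΓr : (Γ : ℝ) = 2 * κ * Real.exp (4 * C) := by
    rw [hΓ]; push_cast; rw [Real.coe_toNNReal _ (Real.exp_pos _).le]
  have hexp : 1 ≤ Real.exp (4 * (C : ℝ)) := Real.one_le_exp (by positivity)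
  have hΓ2 : 2 * (κ : ℝ) ≤ Γ := by rw [hΓr]; exact le_mul_of_one_le_right (by positivity) hexp
  have hΓ1 : (1 : ℝ) < Γ := by linarith
  have hlogΓ : 0 < Real.log Γ := Real.log_pos hΓ1
  have hlog8 : 0 < Real.log (8 * d) := Real.log_pos (by linarith)
  have hΓpos : 0 < Γ := by exact_mod_cast (by linarith : (0 : ℝ) < Γ)
  have hdpos : (0 : ℝ≥0) < d := by exact_mod_cast (by omega : 0 < d)
  refine ⟨D * (D * Real.log (8 * d) + Real.log Γ), by positivity,
    min α₁ (min (1 / Γ) ((1 / (2 * d)) ^ (d - 2))),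
    lt_min hα₁ (lt_min (by positivity) (by positivity)), fun α hα hlt K hK => ?_⟩
  have h1 : α ≤ α₁ := hlt.le.trans (min_le_left _ _)
  have h2 : α < 1 / Γ := hlt.trans_le ((min_le_right _ _).trans (min_le_left _ _))
  have h3 : α < (1 / (2 * d)) ^ (d - 2) := hlt.trans_le ((min_le_right _ _).trans (min_le_right _ _))
  have hα0 : (0 : ℝ) < α := by exact_mod_cast hα
  have hη1 : (Γ : ℝ) * α < 1 := by
    have : α * Γ < 1 := (lt_div_iff₀ hΓpos).1 h2
    rw [mul_comm]; exact_mod_cast this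
  have hα1 : (α : ℝ) < 1 := by nlinarith
  set X : ℝ := Real.log (1 / (α : ℝ)) with hX
  have hX' : X = -Real.log α := by rw [hX, one_div, Real.log_inv]
  have hX0 : 0 < X := by rw [hX']; linarith [Real.log_neg hα0 hα1]
  -- With this ratio, crossing the outer buffer has mass O(α), the order of the local crossing
  -- probability. Smallness of α also gives t ≥ 2d, and rounding up costs at most a factor 2.
  set t : ℝ := (1 / (α : ℝ)) ^ (1 / D) with ht
  have hα1' : 1 ≤ 1 / (α : ℝ) := by rw [le_div_iff₀ hα0]; linarith
  have ht1 : 1 ≤ t := Real.one_le_rpow hα1' (by positivity)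
  have htD : t ^ (d - 2) = 1 / α := by
    rw [ht, ← Real.rpow_natCast, ← Real.rpow_mul (by positivity), hDnat, one_div_mul_cancel (by linarith),
      Real.rpow_one]
  have ht2 : 2 * (d : ℝ) ≤ t := by
    refine le_of_lt (lt_of_pow_lt_pow_left₀ (d - 2) (by positivity) ?_)
    rw [htD, lt_div_iff₀ hα0]
    have : (α : ℝ) < (1 / (2 * d)) ^ (d - 2) := by exact_mod_cast h3
    calc (2 * (d : ℝ)) ^ (d - 2) * α < (2 * (d : ℝ)) ^ (d - 2) * (1 / (2 * d)) ^ (d - 2) := by gcongr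
      _ = 1 := by rw [← mul_pow, mul_one_div_cancel (by positivity), one_pow]
  set a' : ℕ := ⌈t⌉₊ with ha'
  have hat : t ≤ a' := Nat.le_ceil t
  have hat2 : (a' : ℝ) ≤ 2 * t := by linarith [Nat.ceil_lt_add_one (by linarith : 0 ≤ t)]
  have ha'2 : 2 * d ≤ a' := by exact_mod_cast ht2.trans hat
  have ha'pow : (1 / (a' : ℝ)) ^ (d - 2) ≤ α := by
    calc (1 / (a' : ℝ)) ^ (d - 2) ≤ (1 / t) ^ (d - 2) := by gcongr
      _ = α := by rw [one_div_pow, htD, one_div_one_div]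
  set L : ℕ := 2 * d * 2 * a' with hL
  have hL2 : 2 ≤ L := by rw [hL]; nlinarith
  have hLr : (L : ℝ) = 4 * d * a' := by rw [hL]; push_cast; ring
  have hpow : ∀ k N, 1 * L ^ k ≤ N → (loopLaw d α).real (arm Set.univ 0 0 N) ≤ (Γ * α) ^ k := by
    intro k N hN
    have hp1 : 2 * (κ : ℝ) * α ≤ 1 := by
      have := mul_le_mul_of_nonneg_right hΓ2 hα0.le
      linarith
    refine (loopLaw_arm_le_pow_small hd hC hα hκ hp1 (fun n hn => ?_) ha'2 ha'pow hN).trans_eq ?_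
    · exact (real_le_of_le_coe (hα₁' α h1 n hn 0)).trans_eq (by push_cast; rfl)
    · rw [hΓr]; ring
  obtain ⟨A, hA, hbound⟩ := exists_rpow_bound_of_scales (fun N => measureReal_le_one)
    (by positivity : (0 : ℝ) < Γ * α) hη1.le hL2 le_rfl hpow
  refine ⟨A, fun N hN => (hbound N hN).trans (mul_le_mul_of_nonneg_left ?_ hA.le)⟩
  refine Real.rpow_le_rpow_of_exponent_le (by exact_mod_cast hN) ?_
  have hlogL : Real.log L ≤ Real.log (8 * d) + X / D := by
    have h8 : (L : ℝ) ≤ 8 * d * t := by rw [hLr]; nlinarith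
    refine (Real.log_le_log (by exact_mod_cast (by omega : 0 < L)) h8).trans (le_of_eq ?_)
    rw [Real.log_mul (by positivity) (by positivity), ht, Real.log_rpow (by positivity), ← hX]
    ring
  have hlogL0 : 0 < Real.log L := Real.log_pos (by exact_mod_cast (by omega : 1 < L))
  have hlogη : Real.log (Γ * α) = Real.log Γ - X := by
    rw [Real.log_mul (by positivity) (by positivity), hX']; ring
  rw [hlogη]
  exact exponent_le (by linarith) hX0 hlog8.le hlogL0 hlogL
    (by rw [← hlogη]; exact Real.log_neg (by positivity) hη1) (le_trans (by positivity) hK) hK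

theorem tendsto_exponent (D K : ℝ) :
    Tendsto (fun α : ℝ≥0 => D - K / Real.log (1 / (α : ℝ))) (𝓝[>] 0) (𝓝 D) := by
  have h1 : Tendsto (fun α : ℝ≥0 => (α : ℝ)) (𝓝[>] 0) (𝓝[>] 0) := by
    refine tendsto_nhdsWithin_iff.2 ⟨?_, ?_⟩
    · exact (NNReal.continuous_coe.tendsto' 0 0 rfl).mono_left nhdsWithin_le_nhds
    · filter_upwards [self_mem_nhdsWithin] with α hα
      exact NNReal.coe_pos.2 hα
  have h2 : Tendsto (fun α : ℝ≥0 => Real.log (1 / (α : ℝ))) (𝓝[>] 0) atTop := by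
    simp only [one_div]
    exact Real.tendsto_log_atTop.comp (tendsto_inv_nhdsGT_zero.comp h1)
  simpa using (h2.const_div_atTop K).const_sub D

end LoopPercolation

theorem theorem1p3 (d : ℕ) (hd : 3 ≤ d) :
    0 < LoopPercolation.crossingThreshold d ∧
    ∃ K₀ : ℝ, 0 < K₀ ∧ ∀ K : ℝ, K₀ ≤ K → ∃ C c : ℝ≥0 → ℝ,
      (∀ α : ℝ≥0, 0 < α → (α : ℝ≥0∞) < LoopPercolation.crossingThreshold d →
        0 < c α ∧
        ∀ N : ℕ, 1 ≤ N →
          LoopPercolation.connectProb d α {0}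
              (LoopPercolation.boundary (LoopPercolation.box d N)) ≤
            C α * (N : ℝ) ^ (-(c α))) ∧
      Tendsto c (𝓝[>] 0) (𝓝 ((d : ℝ) - 2)) ∧
      ∀ᶠ α in 𝓝[>] (0 : ℝ≥0), c α = (d : ℝ) - 2 - K / Real.log (1 / (α : ℝ)) := by
  classical
  refine ⟨LoopPercolation.crossingThreshold_pos hd, ?_⟩
  obtain ⟨K₀, hK₀, α₀, hα₀, hsmall⟩ := LoopPercolation.exists_arm_decay_small hd
  refine ⟨K₀, hK₀, fun K hK => ?_⟩
  have hex : ∀ α : ℝ≥0, ∃ x : ℝ × ℝ,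
      (0 < α → (α : ℝ≥0∞) < LoopPercolation.crossingThreshold d → 0 < x.2 ∧ ∀ N : ℕ, 1 ≤ N →
        LoopPercolation.connectProb d α {0} (LoopPercolation.boundary (LoopPercolation.box d N)) ≤
          x.1 * (N : ℝ) ^ (-x.2)) ∧
      (0 < α → α < α₀ → 0 < (d : ℝ) - 2 - K / Real.log (1 / (α : ℝ)) →
        x.2 = (d : ℝ) - 2 - K / Real.log (1 / (α : ℝ))) := by
    intro α
    -- The explicit exponent is used wherever it is proved and positive, which holds eventually as α
    -- → 0; the soft exponent covers the remaining subcritical α.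
    by_cases hgood : 0 < α ∧ α < α₀ ∧ 0 < (d : ℝ) - 2 - K / Real.log (1 / (α : ℝ))
    · obtain ⟨C, hC⟩ := hsmall α hgood.1 hgood.2.1 K hK
      exact ⟨(C, _), fun _ _ => ⟨hgood.2.2, fun N hN =>
        (LoopPercolation.connectProb_zero_le_arm α N).trans (hC N hN)⟩, fun _ _ _ => rfl⟩
    · by_cases hlt : 0 < α ∧ (α : ℝ≥0∞) < LoopPercolation.crossingThreshold d
      · obtain ⟨C, c, hc, hC⟩ := LoopPercolation.exists_arm_decay hd hlt.1 hlt.2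
        exact ⟨(C, c), fun _ _ => ⟨hc, fun N hN =>
          (LoopPercolation.connectProb_zero_le_arm α N).trans (hC N hN)⟩,
          fun h1 h2 h3 => absurd ⟨h1, h2, h3⟩ hgood⟩
      · exact ⟨(0, 0), fun h1 h2 => absurd ⟨h1, h2⟩ hlt, fun h1 h2 h3 => absurd ⟨h1, h2, h3⟩ hgood⟩
  choose x hx1 hx2 using hex
  have hD : (0 : ℝ) < (d : ℝ) - 2 := by
    have : (3 : ℝ) ≤ d := by exact_mod_cast hd
    linarith
  have hlim := LoopPercolation.tendsto_exponent ((d : ℝ) - 2) K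
  have hev : ∀ᶠ α in 𝓝[>] (0 : ℝ≥0), (x α).2 = (d : ℝ) - 2 - K / Real.log (1 / (α : ℝ)) := by
    filter_upwards [self_mem_nhdsWithin, nhdsWithin_le_nhds (gt_mem_nhds hα₀),
      hlim.eventually (lt_mem_nhds hD)] with α h1 h2 h3
    exact hx2 α h1 h2 h3
  exact ⟨fun α => (x α).1, fun α => (x α).2, hx1, hlim.congr' (hev.mono fun _ h => h.symm), hev⟩
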